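/- **Setting.** Let $n,m\ge 1$. The true system is $x_{t+1}=Ax_t+Bu_t$ with $A\in\mathbb R^{n\times n}$, $B\in\mathbb R^{n\times m}$. Inputs are restricted to a bounded polyhedron $\mathcal U=\{u\in\mathbb R^m: F_u u\le \mathbf 1\}$. Let $Q,R\succ0$ be symmetric, $\|x\|_Q^2=x^\top Qx$, $l(x,u)=\|x\|_Q^2+\|u\|_R^2$. Let $\overline\sigma,\underline\sigma$ denote largest and smallest eigenvalue and $r_Q=\overline\sigma_Q/\underline\sigma_Q$. Set $V_\infty(x)=\inf\sum_{t\ge0}l(x_t,u_t)\in[0,\infty]$ over all input sequences in $\mathcal U$ for the true system started at $x$, and $\mathcal X_{\rm ROA}=\{x: V_\infty(x)<\infty\}$. An estimated model satisfies $\|\widehat A-A\|_{\rm F}\le\delta_A$, $\|\widehat B-B\|_{\rm F}\le\delta_B$. For $N\ge1$ let $\widehat{\mathbf u}^*_N(x)=(u_0,\dots,u_N)$ minimize $\sum_{k=0}^{N}l(x_k,u_k)$ subject to $x_0=x$, $x_{k+1}=\widehat Ax_k+\widehat Bu_k$, $u_k\in\mathcal U$; let $\widehat V_N(x)$ be the minimum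 and $\hat\mu_N(x)=u_0$. Let $J_\infty^{[\hat\mu_N]}(x)=\sum_{t\ge0}l(x_t,\hat\mu_N(x_t))$ along $x_{t+1}=Ax_t+B\hat\mu_N(x_t)$, $x_0=x$. **Constants in $\xi_N,\eta_N$.** Choose $K\in\mathbb R^{m\times n}$, $\lambda_K\ge1$, $\rho_K\in(0,1)$ with $\|(\widehat A+\widehat BK)^k\|_2\le\lambda_K\rho_K^{k/2}$ for all $k\in\mathbb N$, and $\varepsilon_K>0$ such that $\|x\|_Q^2\le\varepsilon_K$ implies $K(\widehat A+\widehat BK)^kx\in\mathcal U$ for all $k\in\mathbb N$. Let $M\in\mathbb R$ be a level of $\widehat V_N$. Put $$\gamma=\frac{(1+\underline\sigma_Q^{-1}\overline\sigma_R\|K\|_2^2)\,r_Q\lambda_K^2}{1-\rho_K},\quad \rho_\gamma=\frac{\gamma-1}{\gamma},\quad L_{\widehat V}=\max\{\gamma,M/\varepsilon_K\},\quad N_0=\Big\lceil\max\{0,\tfrac{M-\gamma\varepsilon_K}{\varepsilon_K}\}\Big\rceil,$$ $$\eta_N=\|\widehat A\|_2^2\,r_Q\,\gamma\rho_\gamma^{N-N_0},\quad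 h=\underline\sigma_Q^{-1}\delta_A^2+\underline\sigma_R^{-1}\delta_B^2,\quad G_N=\sum_{i=1}^{N-1}\|\widehat A\|_2^{2(i-1)},$$ $$\omega_{N,(1)}=\overline\sigma_Q\big[(1+\|\widehat A\|_2^2r_Q)\|\widehat A\|_2^{2(N-1)}+G_N\big],$$ $$\omega_{N,(\frac12)}=\big[\overline\sigma_Q(L_{\widehat V}-1)G_N\big]^{\frac12}+(1+\|\widehat A\|_2^2r_Q)\big[\overline\sigma_Q\|\widehat A\|_2^{2(N-1)}\gamma\rho_\gamma^{N-N_0}\big]^{\frac12},$$ $$\xi_N(\delta_A,\delta_B)=\omega_{N,(1)}h+2\omega_{N,(\frac12)}h^{\frac12}.$$ **Constants in $\alpha_N,\beta_N$.** Let $p_i,q_i>0$ with $p_iq_i=1$ ($i=1,2,3$), $\bar u=\max_{u\in\mathcal U}\|u\|_2^2$, $\bar d_u=\max_{u,v\in\mathcal U}\|u-v\|_2^2$, $g_{i,(x)}=(\delta_A+\|\widehat A\|_2)^i-\|\widehat A\|_2^i$, $g_{i,(u)}=(\delta_B+\|\widehat B\|_2)g_{i,(x)}+\delta_B\|\widehat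 A\|_2^i$, $\bar g_{(x)}=\sum_{i=1}^Ng_{i,(x)}$, $\bar g_{(u)}=\sum_{i=1}^N\sum_{j=0}^{i-1}g_{j,(u)}$. Let $\widehat\Phi_N$ be the block column $[I;\widehat A;\dots;\widehat A^N]$, $\widehat\Gamma_N$ the block matrix with blocks $\widehat A^{i-1-j}\widehat B$ for $0\le j<i\le N$ and $0$ for $0\le i\le j\le N-1$, and $\widehat H_N=I_N\otimes R+\widehat\Gamma_N^\top(I_{N+1}\otimes Q)\widehat\Gamma_N$. Put $$\theta_{N,(u)}=\overline\sigma_Q(2\|\widehat\Gamma_N\|_2\bar g_{(u)}+\bar g_{(u)}^2),\quad\theta_{N,(x,u)}=\overline\sigma_Q(\|\widehat\Gamma_N\|_2\bar g_{(x)}+\|\widehat\Phi_N\|_2\bar g_{(u)}+\bar g_{(x)}\bar g_{(u)}),$$ $$\Delta_u(x)=\min\Big\{(N\bar d_u)^{\frac12},\ \underline\sigma_{\widehat H_N}^{-1}\big((N\bar u)^{\frac12}\theta_{N,(u)}+\|x\|_2\theta_{N,(x,u)}\big)\Big\},$$ $$E_\psi=\overline\sigma_Q\sum_{k=0}^N\Big(g_{k,(x)}^2+\sum_{i=0}^{k-1}g_{k-i-1,(u)}^2\Big)(\|x\|_2^2+k\bar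 u),\quad E_u=\overline\sigma_R\Delta_u(x)^2,\quad E_{\psi,u}=\frac{\overline\sigma_Q}{\overline\sigma_R}(\|\widehat\Gamma_N\|_2+\bar g_{(u)})^2E_u,$$ $$\alpha_N=\max\big\{p_1E_\psi^{\frac12}+p_3E_{\psi,u}^{\frac12}+p_1p_3(E_\psi E_{\psi,u})^{\frac12},\ p_2E_u^{\frac12}\big\},$$ $$\beta_N=(1+p_1E_\psi^{\frac12})(q_3E_{\psi,u}^{\frac12}+E_{\psi,u})+q_2E_u^{\frac12}+E_u+q_1E_\psi^{\frac12}+E_\psi,$$ where $\alpha_N,\beta_N$ are evaluated at the initial state $x$. **Theorem.** Suppose $\xi_N(\delta_A,\delta_B)+\eta_N<1$. Then: 1. The optimization problem defining $\hat\mu_N$, which involves only $\widehat A,\widehat B,Q,R,\mathcal U,N$, has exactly one solution at every $x\in\mathbb{R}^n$. 2. The certainty-equivalent MPC law $\hat\mu_N$ stabilizes the true system: the origin is Lyapunov stable for $x_{t+1}=Ax_t+B\hat\mu_N(x_t)$, and $x_t\to0$ from every $x_0=x\in\mathcal X_{\rm ROA}$ with $\widehat V_N(x)\le M$. 3. For every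 $x\in\mathcal X_{\rm ROA}$ with $\widehat V_N(x)\le M$, the closed-loop cost is finite and $$J_\infty^{[\hat\mu_N]}(x)\le\frac{(1+\alpha_N)V_\infty(x)+\beta_N}{1-\xi_N-\eta_N}.$$ 4. If $\delta_A=\delta_B=0$, then $\alpha_N=\beta_N=\xi_N=0$, and the bound reduces to $J_\infty^{[\hat\mu_N]}(x)\le V_\infty(x)/(1-\eta_N)$. (The level $M$ is arbitrary: any $x\in\mathcal X_{\rm ROA}$ is covered by taking $M\ge\widehat V_N(x)$, with the constants $L_{\widehat V},N_0$ computed for that $M$.) -/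

import Mathlib

open scoped Matrix ENNReal Topology

noncomputable section

namespace CEMPC

/-! ### Norms and eigenvalues -/

/-- The Euclidean norm of a coordinate vector. -/
def norm2 {ι : Type} [Fintype ι] (x : ι → ℝ) : ℝ := Real.sqrt (∑ i, x i ^ 2)

/-- The weighted square `‖x‖²_W = xᵀ W x`. -/
def wsq {ι : Type} [Fintype ι] (W : Matrix ι ι ℝ) (x : ι → ℝ) : ℝ := x ⬝ᵥ (W *ᵥ x)

/-- The Frobenius norm of a matrix. -/
def frobNorm {ι κ : Type} [Fintype ι] [Fintype κ] (M : Matrix ι κ ℝ) : ℝ :=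
  Real.sqrt (∑ i, ∑ j, M i j ^ 2)

open scoped Matrix.Norms.L2Operator in
/-- The spectral norm `‖M‖₂`, i.e. the operator norm induced by the Euclidean norms. -/
def specNorm {ι κ : Type} [Fintype ι] [Fintype κ] [DecidableEq κ] (M : Matrix ι κ ℝ) : ℝ := ‖M‖

/-- The largest eigenvalue of a symmetric matrix. -/
def eigMax {ι : Type} [Fintype ι] [DecidableEq ι] (W : Matrix ι ι ℝ) : ℝ := sSup (spectrum ℝ W)

/-- The smallest eigenvalue of a symmetric matrix. -/
def eigMin {ι : Type} [Fintype ι] [DecidableEq ι] (W : Matrix ι ι ℝ) : ℝ := sInf (spectrum ℝ W)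

/-! ### Dynamics, constraints and optimal control problems -/

/-- The polyhedral input constraint set `{u | F u ≤ 1}` (entrywise). -/
def inputSet {m c : ℕ} (F : Matrix (Fin c) (Fin m) ℝ) : Set (Fin m → ℝ) :=
  {u | ∀ i, (F *ᵥ u) i ≤ 1}

/-- The quadratic stage cost `l(x, u) = ‖x‖²_Q + ‖u‖²_R`. -/
def stageCost {n m : ℕ} (Q : Matrix (Fin n) (Fin n) ℝ) (R : Matrix (Fin m) (Fin m) ℝ)
    (x : Fin n → ℝ) (u : Fin m → ℝ) : ℝ := wsq Q x + wsq R u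

/-- Open-loop state of `x_{k+1} = A x_k + B u_k`, `x_0 = x`. -/
def openLoop {n m : ℕ} (A : Matrix (Fin n) (Fin n) ℝ) (B : Matrix (Fin n) (Fin m) ℝ)
    (x : Fin n → ℝ) (u : ℕ → Fin m → ℝ) : ℕ → Fin n → ℝ
  | 0 => x
  | k + 1 => A *ᵥ openLoop A B x u k + B *ᵥ u k

/-- Closed-loop state of `x_{t+1} = A x_t + B μ(x_t)`, `x_0 = x`. -/
def closedLoop {n m : ℕ} (A : Matrix (Fin n) (Fin n) ℝ) (B : Matrix (Fin n) (Fin m) ℝ)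
    (μ : (Fin n → ℝ) → Fin m → ℝ) (x : Fin n → ℝ) : ℕ → Fin n → ℝ
  | 0 => x
  | t + 1 => A *ᵥ closedLoop A B μ x t + B *ᵥ μ (closedLoop A B μ x t)

/-- The infinite-horizon cost `∑_{t ≥ 0} l(x_t, u_t)` of an input sequence. -/
def costInf {n m : ℕ} (A : Matrix (Fin n) (Fin n) ℝ) (B : Matrix (Fin n) (Fin m) ℝ)
    (Q : Matrix (Fin n) (Fin n) ℝ) (R : Matrix (Fin m) (Fin m) ℝ)
    (x : Fin n → ℝ) (u : ℕ → Fin m → ℝ) : ℝ≥0∞ :=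
  ∑' t, ENNReal.ofReal (stageCost Q R (openLoop A B x u t) (u t))

/-- The optimal value of the infinite-horizon problem with inputs in `inputSet F`. -/
def valueInf {n m c : ℕ} (A : Matrix (Fin n) (Fin n) ℝ) (B : Matrix (Fin n) (Fin m) ℝ)
    (Q : Matrix (Fin n) (Fin n) ℝ) (R : Matrix (Fin m) (Fin m) ℝ) (F : Matrix (Fin c) (Fin m) ℝ)
    (x : Fin n → ℝ) : ℝ≥0∞ :=
  ⨅ u ∈ {u : ℕ → Fin m → ℝ | ∀ t, u t ∈ inputSet F}, costInf A B Q R x u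

/-- The region of attraction: the states with finite optimal infinite-horizon cost. -/
def regionOfAttraction {n m c : ℕ} (A : Matrix (Fin n) (Fin n) ℝ) (B : Matrix (Fin n) (Fin m) ℝ)
    (Q : Matrix (Fin n) (Fin n) ℝ) (R : Matrix (Fin m) (Fin m) ℝ)
    (F : Matrix (Fin c) (Fin m) ℝ) : Set (Fin n → ℝ) :=
  {x | valueInf A B Q R F x < ⊤}

/-- The infinite-horizon cost of the closed loop under the state feedback `μ`. -/
def closedLoopCost {n m : ℕ} (A : Matrix (Fin n) (Fin n) ℝ) (B : Matrix (Fin n) (Fin m) ℝ)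
    (Q : Matrix (Fin n) (Fin n) ℝ) (R : Matrix (Fin m) (Fin m) ℝ)
    (μ : (Fin n → ℝ) → Fin m → ℝ) (x : Fin n → ℝ) : ℝ≥0∞ :=
  ∑' t, ENNReal.ofReal
    (stageCost Q R (closedLoop A B μ x t) (μ (closedLoop A B μ x t)))

/-- A finite input sequence `u_0, …, u_N`, continued by zero. -/
def extendInput {m N : ℕ} (u : Fin (N + 1) → Fin m → ℝ) (k : ℕ) : Fin m → ℝ :=
  if h : k < N + 1 then u ⟨k, h⟩ else 0

/-- The truncated cost `∑_{k=0}^{N} l(x_k, u_k)`. -/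
def costN {n m N : ℕ} (A : Matrix (Fin n) (Fin n) ℝ) (B : Matrix (Fin n) (Fin m) ℝ)
    (Q : Matrix (Fin n) (Fin n) ℝ) (R : Matrix (Fin m) (Fin m) ℝ)
    (x : Fin n → ℝ) (u : Fin (N + 1) → Fin m → ℝ) : ℝ :=
  ∑ k : Fin (N + 1), stageCost Q R (openLoop A B x (extendInput u) k) (u k)

/-- The data available to the controller: the estimated model, the weights, the input
constraints and the prediction horizon. The true system is not part of it. -/
structure Controller (n m c : ℕ) where
  Ah : Matrix (Fin n) (Fin n) ℝ
  Bh : Matrix (Fin n) (Fin m) ℝ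
  Q : Matrix (Fin n) (Fin n) ℝ
  R : Matrix (Fin m) (Fin m) ℝ
  F : Matrix (Fin c) (Fin m) ℝ
  N : ℕ

namespace Controller

variable {n m c : ℕ} (C : Controller n m c)

/-- `u` solves the MPC problem of the estimated model at the state `x`. -/
def IsOptimal (x : Fin n → ℝ) (u : Fin (C.N + 1) → Fin m → ℝ) : Prop :=
  (∀ k, u k ∈ inputSet C.F) ∧
    ∀ v : Fin (C.N + 1) → Fin m → ℝ, (∀ k, v k ∈ inputSet C.F) →
      costN C.Ah C.Bh C.Q C.R x u ≤ costN C.Ah C.Bh C.Q C.R x v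

/-- The optimal input sequence of the MPC problem of the estimated model. -/
def optInput (x : Fin n → ℝ) : Fin (C.N + 1) → Fin m → ℝ :=
  Classical.epsilon (C.IsOptimal x)

/-- The optimal value `V̂_N(x)` of the MPC problem of the estimated model. -/
def value (x : Fin n → ℝ) : ℝ := costN C.Ah C.Bh C.Q C.R x (C.optInput x)

/-- The certainty-equivalent MPC law `μ̂_N`: the first optimal input. -/
def law (x : Fin n → ℝ) : Fin m → ℝ := C.optInput x 0

/-! ### Quantities entering `α_N` and `β_N` -/

/-- `ū`, the maximum of `‖u‖₂²` over the input constraint set. -/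
def uMax : ℝ := sSup {r | ∃ u ∈ inputSet C.F, r = norm2 u ^ 2}

/-- `d̄_u`, the maximum of `‖u - v‖₂²` over the input constraint set. -/
def uDiam : ℝ := sSup {r | ∃ u ∈ inputSet C.F, ∃ v ∈ inputSet C.F, r = norm2 (u - v) ^ 2}

/-- `g_{i,(x)}`. -/
def gx (δA : ℝ) (i : ℕ) : ℝ := (δA + specNorm C.Ah) ^ i - specNorm C.Ah ^ i

/-- `g_{i,(u)}`. -/
def gu (δA δB : ℝ) (i : ℕ) : ℝ :=
  (δB + specNorm C.Bh) * C.gx δA i + δB * specNorm C.Ah ^ i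

/-- `ḡ_{(x)}`. -/
def gxSum (δA : ℝ) : ℝ := ∑ i ∈ Finset.Icc 1 C.N, C.gx δA i

/-- `ḡ_{(u)}`. -/
def guSum (δA δB : ℝ) : ℝ := ∑ i ∈ Finset.Icc 1 C.N, ∑ j ∈ Finset.range i, C.gu δA δB j

/-- The block column `Φ̂_N = [I; Â; …; Â^N]`. -/
def Phi : Matrix (Fin (C.N + 1) × Fin n) (Fin n) ℝ :=
  Matrix.of fun p b => (C.Ah ^ (p.1 : ℕ)) p.2 b

/-- The block lower triangular matrix `Γ̂_N`, with blocks `Â^{i-1-j} B̂` for `j < i`. -/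
def Gam : Matrix (Fin (C.N + 1) × Fin n) (Fin C.N × Fin m) ℝ :=
  Matrix.of fun p q =>
    if (q.1 : ℕ) < (p.1 : ℕ) then (C.Ah ^ ((p.1 : ℕ) - 1 - (q.1 : ℕ)) * C.Bh) p.2 q.2 else 0

/-- `Ĥ_N = I_N ⊗ R + Γ̂_Nᵀ (I_{N+1} ⊗ Q) Γ̂_N`. -/
def Hess : Matrix (Fin C.N × Fin m) (Fin C.N × Fin m) ℝ :=
  Matrix.kronecker (1 : Matrix (Fin C.N) (Fin C.N) ℝ) C.R +
    C.Gamᵀ * Matrix.kronecker (1 : Matrix (Fin (C.N + 1)) (Fin (C.N + 1)) ℝ) C.Q * C.Gam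

/-- `θ_{N,(u)}`. -/
def thetaU (δA δB : ℝ) : ℝ :=
  eigMax C.Q * (2 * specNorm C.Gam * C.guSum δA δB + C.guSum δA δB ^ 2)

/-- `θ_{N,(x,u)}`. -/
def thetaXU (δA δB : ℝ) : ℝ :=
  eigMax C.Q * (specNorm C.Gam * C.gxSum δA + specNorm C.Phi * C.guSum δA δB +
    C.gxSum δA * C.guSum δA δB)

/-- `Δ_{N,(δu)}(x)`. -/
def deltaU (δA δB : ℝ) (x : Fin n → ℝ) : ℝ :=
  min (Real.sqrt (C.N * C.uDiam))
    ((eigMin C.Hess)⁻¹ *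
      (Real.sqrt (C.N * C.uMax) * C.thetaU δA δB + norm2 x * C.thetaXU δA δB))

/-- `Δ_{N,(ψ)}(x)`. -/
def deltaPsi (δA δB : ℝ) (x : Fin n → ℝ) : ℝ :=
  ∑ k ∈ Finset.range (C.N + 1),
    (C.gx δA k ^ 2 + ∑ i ∈ Finset.range k, C.gu δA δB (k - 1 - i) ^ 2) *
      (norm2 x ^ 2 + k * C.uMax)

/-- `E_{N,(ψ)}`. -/
def errPsi (δA δB : ℝ) (x : Fin n → ℝ) : ℝ := eigMax C.Q * C.deltaPsi δA δB x

/-- `E_{N,(u)}`. -/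
def errU (δA δB : ℝ) (x : Fin n → ℝ) : ℝ := eigMax C.R * C.deltaU δA δB x ^ 2

/-- `E_{N,(ψ,u)}`. -/
def errPsiU (δA δB : ℝ) (x : Fin n → ℝ) : ℝ :=
  eigMax C.Q / eigMax C.R * (specNorm C.Gam + C.guSum δA δB) ^ 2 * C.errU δA δB x

/-- `α_N`, for the parameters `p₁, p₂, p₃`. -/
def alpha (p₁ p₂ p₃ δA δB : ℝ) (x : Fin n → ℝ) : ℝ :=
  max
    (p₁ * Real.sqrt (C.errPsi δA δB x) + p₃ * Real.sqrt (C.errPsiU δA δB x) +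
      p₁ * p₃ * Real.sqrt (C.errPsi δA δB x * C.errPsiU δA δB x))
    (p₂ * Real.sqrt (C.errU δA δB x))

/-- `β_N`, for the parameters `p₁` and `q₁, q₂, q₃`. -/
def beta (p₁ q₁ q₂ q₃ δA δB : ℝ) (x : Fin n → ℝ) : ℝ :=
  (1 + p₁ * Real.sqrt (C.errPsi δA δB x)) *
      (q₃ * Real.sqrt (C.errPsiU δA δB x) + C.errPsiU δA δB x) +
    q₂ * Real.sqrt (C.errU δA δB x) + C.errU δA δB x +
    q₁ * Real.sqrt (C.errPsi δA δB x) + C.errPsi δA δB x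

end Controller

/-! ### Quantities entering `ξ_N` and `η_N` -/

/-- Parameters of the local analysis: a linear gain `K`, the constants `λ_K`, `ρ_K` of the
exponential decay of `Â + B̂ K`, the size `ε_K` of the local region `{x | ‖x‖²_Q ≤ ε_K}`, and a
level `M` of the value function `V̂_N`. -/
structure LocalData (n m : ℕ) where
  K : Matrix (Fin m) (Fin n) ℝ
  lam : ℝ
  rho : ℝ
  eps : ℝ
  M : ℝ

/-- `L` is admissible for `C`: `‖(Â + B̂K)^k‖₂ ≤ λ_K (√ρ_K)^k` for all `k`, and on the local region
the linear law `u = K x` respects the input constraints along the whole local closed loop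
`x_{k+1} = (Â + B̂ K) x_k`. -/
structure LocalData.Admissible {n m c : ℕ} (L : LocalData n m) (C : Controller n m c) : Prop where
  one_le_lam : 1 ≤ L.lam
  rho_pos : 0 < L.rho
  rho_lt_one : L.rho < 1
  decay : ∀ k : ℕ, specNorm ((C.Ah + C.Bh * L.K) ^ k) ≤ L.lam * Real.sqrt L.rho ^ k
  eps_pos : 0 < L.eps
  feasible : ∀ x : Fin n → ℝ, wsq C.Q x ≤ L.eps →
    ∀ k : ℕ, L.K *ᵥ ((C.Ah + C.Bh * L.K) ^ k *ᵥ x) ∈ inputSet C.F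

namespace Controller

variable {n m c : ℕ} (C : Controller n m c) (L : LocalData n m)

/-- `r_Q`, the ratio of the extreme eigenvalues of `Q`. -/
def ratioQ : ℝ := eigMax C.Q / eigMin C.Q

/-- `C*_K = (1 + σ_min(Q)⁻¹ σ_max(R) ‖K‖₂²) r_Q λ_K²`. -/
def cStar : ℝ :=
  (1 + (eigMin C.Q)⁻¹ * eigMax C.R * specNorm L.K ^ 2) * C.ratioQ * L.lam ^ 2

/-- `γ = C*_K / (1 - ρ_K)`. -/
def gam : ℝ := C.cStar L / (1 - L.rho)

/-- `ρ_γ = (γ - 1) / γ`. -/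
def rhoGam : ℝ := (C.gam L - 1) / C.gam L

/-- `L_V̂ = max {γ, M / ε_K}`. -/
def lV : ℝ := max (C.gam L) (L.M / L.eps)

/-- `N₀ = ⌈max {0, (M - γ ε_K) / ε_K}⌉`. -/
def horizon0 : ℕ := ⌈max 0 ((L.M - C.gam L * L.eps) / L.eps)⌉₊

/-- `γ ρ_γ^{N - N₀}`, with an integer exponent. -/
def tailFactor : ℝ := C.gam L * C.rhoGam L ^ ((C.N : ℤ) - (C.horizon0 L : ℤ))

/-- `η_N`. -/
def eta : ℝ := specNorm C.Ah ^ 2 * C.ratioQ * C.tailFactor L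

/-- `G_N(Â) = ∑_{i=1}^{N-1} ‖Â‖₂^{2(i-1)}`. -/
def geomSum : ℝ := ∑ i ∈ Finset.range (C.N - 1), (specNorm C.Ah ^ 2) ^ i

/-- `ω_{N,(1)}`. -/
def omegaOne : ℝ :=
  eigMax C.Q * ((1 + specNorm C.Ah ^ 2 * C.ratioQ) * (specNorm C.Ah ^ 2) ^ (C.N - 1) + C.geomSum)

/-- `ω_{N,(1/2)}`. -/
def omegaHalf : ℝ :=
  Real.sqrt (eigMax C.Q * (C.lV L - 1) * C.geomSum) +
    (1 + specNorm C.Ah ^ 2 * C.ratioQ) *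
      Real.sqrt (eigMax C.Q * (specNorm C.Ah ^ 2) ^ (C.N - 1) * C.tailFactor L)

/-- `h(δ_A, δ_B)`. -/
def hErr (δA δB : ℝ) : ℝ := (eigMin C.Q)⁻¹ * δA ^ 2 + (eigMin C.R)⁻¹ * δB ^ 2

/-- `ξ_N`. -/
def xi (δA δB : ℝ) : ℝ :=
  C.omegaOne * C.hErr δA δB + 2 * C.omegaHalf L * Real.sqrt (C.hErr δA δB)

end Controller

end CEMPC

end

/-! The value function `V̂_N` of the estimated model is a Lyapunov function for the true closed
loop.

The descent step is `value_step_le`. At the true successor state, the old optimal inputs, shifted by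
one and padded with zeros, are a feasible candidate. Their states differ from the old prediction
only by `Âᵏ e`, where `e` is the one-step model error. By Cauchy–Schwarz, `‖e‖² ≤ h · l(x, u₀)`, so
Minkowski's inequality turns the deviation into the loss `ξ_N · l(x, u₀)`. The one stage added at
the end costs at most `‖Â‖² r_Q` times the weighted square of the last shared state. Its nominal
part gives the loss `η_N · l(x, u₀)`.

That nominal state is small by `tail_decay`, applied to the cost-to-go along the optimal prediction.
Outside the local region each step consumes at least `ε_K`. Inside it, the principle of optimality
and the linear gain `K` bound the cost-to-go by `γ` times the current `‖·‖²_Q`, which forces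
geometric decay.

Telescoping the descent gives `(1 - ξ_N - η_N) ∑ l ≤ V̂_N(x)`. This yields stability, convergence
and a bound on the closed-loop cost by `V̂_N(x)`. To reach `V_∞`, an arbitrary admissible input of
the true system is inserted into the estimated problem (`value_le_trajCost`). The open-loop states
then differ by at most `E_ψ` in summed weighted squares, and Young's inequality separates the cross
term. Only the `E_ψ` terms of `α_N` and `β_N` are needed; the others are nonnegative and merely
enlarge the bound. -/

noncomputable section

namespace CEMPC

/-! ### Euclidean, spectral and Frobenius norms -/

section Norms

variable {ι κ : Type} [Fintype ι] [Fintype κ]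

theorem norm2_eq_norm (x : ι → ℝ) : norm2 x = ‖WithLp.toLp 2 x‖ := by
  simp [norm2, EuclideanSpace.norm_eq]

theorem norm2_nonneg (x : ι → ℝ) : 0 ≤ norm2 x := Real.sqrt_nonneg _

theorem norm2_sq (x : ι → ℝ) : norm2 x ^ 2 = x ⬝ᵥ x := by
  rw [norm2, Real.sq_sqrt (Finset.sum_nonneg fun i _ => sq_nonneg _)]
  simp [dotProduct, sq]

theorem norm2_add_le (x y : ι → ℝ) : norm2 (x + y) ≤ norm2 x + norm2 y := by
  simp only [norm2_eq_norm, WithLp.toLp_add]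
  exact norm_add_le _ _

theorem norm2_neg (x : ι → ℝ) : norm2 (-x) = norm2 x := by
  simp [norm2]

theorem continuous_norm2 : Continuous (norm2 : (ι → ℝ) → ℝ) := by
  unfold norm2
  fun_prop

theorem norm2_mulVec_le_specNorm [DecidableEq κ] (M : Matrix ι κ ℝ) (x : κ → ℝ) :
    norm2 (M *ᵥ x) ≤ specNorm M * norm2 x := by
  rw [norm2_eq_norm, norm2_eq_norm, specNorm]
  exact Matrix.l2_opNorm_mulVec M (WithLp.toLp 2 x)

open scoped Matrix.Norms.L2Operator in
theorem specNorm_nonneg [DecidableEq κ] (M : Matrix ι κ ℝ) : 0 ≤ specNorm M := by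
  rw [specNorm]
  exact norm_nonneg _

theorem norm2_mulVec_le_frobNorm (M : Matrix ι κ ℝ) (x : κ → ℝ) :
    norm2 (M *ᵥ x) ≤ frobNorm M * norm2 x := by
  rw [norm2, frobNorm, norm2, ← Real.sqrt_mul (by positivity), Finset.sum_mul]
  refine Real.sqrt_le_sqrt (Finset.sum_le_sum fun i _ => ?_)
  exact Finset.sum_mul_sq_le_sq_mul_sq Finset.univ (M i) x

theorem norm2_pow_mulVec_le [DecidableEq ι] (M : Matrix ι ι ℝ) (x : ι → ℝ) (k : ℕ) :
    norm2 (M ^ k *ᵥ x) ≤ specNorm M ^ k * norm2 x := by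
  induction k with
  | zero => simp
  | succ k ih =>
    rw [pow_succ', ← Matrix.mulVec_mulVec, pow_succ', mul_assoc]
    exact (norm2_mulVec_le_specNorm M _).trans
      (mul_le_mul_of_nonneg_left ih (specNorm_nonneg M))

end Norms

/-! ### Weighted squares and Minkowski's inequality -/

section Weighted

variable {ι : Type} [Fintype ι] {W : Matrix ι ι ℝ}

theorem wsq_nonneg (hW : W.PosSemidef) (x : ι → ℝ) : 0 ≤ wsq W x := by
  simpa [wsq] using hW.dotProduct_mulVec_nonneg x

theorem wsq_zero (W : Matrix ι ι ℝ) : wsq W 0 = 0 := by simp [wsq]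

theorem eq_zero_of_wsq_nonpos (hW : W.PosDef) {x : ι → ℝ} (h : wsq W x ≤ 0) : x = 0 := by
  by_contra hx
  have := hW.dotProduct_mulVec_pos hx
  simp only [star_trivial] at this
  exact absurd h (not_le.mpr this)

theorem continuous_wsq (W : Matrix ι ι ℝ) : Continuous (wsq W) := by
  unfold wsq
  fun_prop

/-- Factoring `W = Sᵀ S` reduces weighted estimates to the Euclidean triangle inequality. -/
theorem exists_wsq_eq_norm2_sq [DecidableEq ι] (hW : W.PosSemidef) :
    ∃ S : Matrix ι ι ℝ, ∀ x, wsq W x = norm2 (S *ᵥ x) ^ 2 := by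
  open scoped MatrixOrder in
  obtain ⟨S, rfl⟩ := CStarAlgebra.nonneg_iff_eq_star_mul_self.mp hW.nonneg
  refine ⟨S, fun x => ?_⟩
  rw [norm2_sq, wsq, ← Matrix.mulVec_mulVec, Matrix.dotProduct_mulVec, Matrix.star_eq_conjTranspose,
    Matrix.vecMul_conjTranspose]
  simp

theorem wsq_midpoint (W : Matrix ι ι ℝ) (x y : ι → ℝ) :
    wsq W ((1 / 2 : ℝ) • (x + y)) = (wsq W x + wsq W y) / 2 - wsq W (x - y) / 4 := by
  simp only [wsq, Matrix.mulVec_smul, Matrix.mulVec_add, Matrix.mulVec_sub, dotProduct_smul,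
    smul_dotProduct, add_dotProduct, dotProduct_add, sub_dotProduct, dotProduct_sub, smul_eq_mul]
  ring

/-- Minkowski's inequality for a family of weighted squares. -/
theorem sum_wsq_add_le [DecidableEq ι] (hW : W.PosSemidef) {σ : Type*} (s : Finset σ)
    (a b : σ → ι → ℝ) {S T : ℝ} (hS : ∑ k ∈ s, wsq W (a k) ≤ S) (hT : ∑ k ∈ s, wsq W (b k) ≤ T) :
    ∑ k ∈ s, wsq W (a k + b k) ≤ (∑ k ∈ s, wsq W (a k)) + 2 * (√S * √T) + T := by
  obtain ⟨D, hD⟩ := exists_wsq_eq_norm2_sq hW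
  simp only [hD] at *
  have h1 : ∀ k ∈ s, norm2 (D *ᵥ (a k + b k)) ^ 2 ≤ norm2 (D *ᵥ a k) ^ 2 +
      2 * (norm2 (D *ᵥ a k) * norm2 (D *ᵥ b k)) + norm2 (D *ᵥ b k) ^ 2 := fun k _ => by
    rw [Matrix.mulVec_add]
    have := pow_le_pow_left₀ (norm2_nonneg _) (norm2_add_le (D *ᵥ a k) (D *ᵥ b k)) 2
    linarith [this, add_sq (norm2 (D *ᵥ a k)) (norm2 (D *ᵥ b k))]
  have h2 := Finset.sum_le_sum h1
  rw [Finset.sum_add_distrib, Finset.sum_add_distrib, ← Finset.mul_sum] at h2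
  -- Only the cross term and the last term are relaxed to `S` and `T`. The sum over `a` stays exact,
  -- so that in the descent estimate it cancels against the nominal cost.
  have h3 := Real.sum_mul_le_sqrt_mul_sqrt s (fun k => norm2 (D *ᵥ a k))
    (fun k => norm2 (D *ᵥ b k))
  have h4 := mul_le_mul (Real.sqrt_le_sqrt hS) (Real.sqrt_le_sqrt hT) (Real.sqrt_nonneg _)
    (Real.sqrt_nonneg _)
  linarith

theorem wsq_add_le [DecidableEq ι] (hW : W.PosSemidef) (a b : ι → ℝ) {S T : ℝ}
    (hS : wsq W a ≤ S) (hT : wsq W b ≤ T) :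
    wsq W (a + b) ≤ wsq W a + 2 * (√S * √T) + T := by
  have := sum_wsq_add_le hW (Finset.univ : Finset Unit) (fun _ => a) (fun _ => b)
    (by simpa using hS) (by simpa using hT)
  simpa using this

end Weighted

/-! ### Extreme eigenvalues as bounds on quadratic forms -/

section Eigenvalues

variable {ι : Type} [Fintype ι] [DecidableEq ι] {W : Matrix ι ι ℝ}

theorem finite_spectrum (hW : W.IsHermitian) : (spectrum ℝ W).Finite := by
  rw [hW.spectrum_real_eq_range_eigenvalues]
  exact Set.finite_range _

theorem nonempty_spectrum [Nonempty ι] (hW : W.IsHermitian) : (spectrum ℝ W).Nonempty := by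
  rw [hW.spectrum_real_eq_range_eigenvalues]
  exact Set.range_nonempty _

/-- Subtracting `a` times the identity translates the spectrum by `-a`, and a Hermitian matrix with
nonnegative eigenvalues is positive semidefinite. -/
theorem posSemidef_sub_smul_one (hW : W.IsHermitian) {a : ℝ} (ha : ∀ r ∈ spectrum ℝ W, a ≤ r) :
    (W - a • (1 : Matrix ι ι ℝ)).PosSemidef := by
  have hH : (W - a • (1 : Matrix ι ι ℝ)).IsHermitian :=
    hW.sub (by simp [Matrix.IsHermitian])
  refine hH.posSemidef_iff_eigenvalues_nonneg.mpr fun i => ?_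
  have h1 := hH.eigenvalues_mem_spectrum_real i
  generalize hH.eigenvalues i = t at h1 ⊢
  rw [← Algebra.algebraMap_eq_smul_one, ← spectrum.sub_singleton_eq] at h1
  obtain ⟨r, hr, s, hs, h⟩ := h1
  have := ha r hr
  simp only [Set.mem_singleton_iff] at hs
  simp only [Pi.zero_apply]
  simp only at h
  linarith

theorem wsq_sub_smul_one (W : Matrix ι ι ℝ) (a : ℝ) (x : ι → ℝ) :
    wsq (W - a • (1 : Matrix ι ι ℝ)) x = wsq W x - a * norm2 x ^ 2 := by
  rw [norm2_sq, wsq, wsq, Matrix.sub_mulVec, Matrix.smul_mulVec, Matrix.one_mulVec,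
    dotProduct_sub, dotProduct_smul, smul_eq_mul]

theorem eigMin_mul_le_wsq (hW : W.IsHermitian) (x : ι → ℝ) :
    eigMin W * norm2 x ^ 2 ≤ wsq W x := by
  have := wsq_nonneg (posSemidef_sub_smul_one hW
    fun r hr => csInf_le (finite_spectrum hW).bddBelow hr) x
  rw [wsq_sub_smul_one] at this
  exact sub_nonneg.mp this

theorem wsq_le_eigMax_mul (hW : W.IsHermitian) (x : ι → ℝ) :
    wsq W x ≤ eigMax W * norm2 x ^ 2 := by
  -- The upper bound is the lower bound for `-W`, whose spectrum is the reflected one.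
  have := wsq_nonneg (posSemidef_sub_smul_one hW.neg (a := -eigMax W) fun r hr => by
    rw [← spectrum.neg_eq, Set.mem_neg] at hr
    have := le_csSup (finite_spectrum hW).bddAbove hr
    simp only [eigMax]
    linarith) x
  rw [wsq_sub_smul_one] at this
  simp only [wsq, Matrix.neg_mulVec, dotProduct_neg] at this ⊢
  linarith

theorem eigMin_pos [Nonempty ι] (hW : W.PosDef) : 0 < eigMin W := by
  have h := (nonempty_spectrum hW.isHermitian).csInf_mem (finite_spectrum hW.isHermitian)
  have h2 := hW.isHermitian.spectrum_real_eq_range_eigenvalues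
  rw [eigMin]
  rw [h2] at h ⊢
  obtain ⟨i, hi⟩ := h
  rw [← hi]
  exact hW.eigenvalues_pos i

theorem eigMin_le_eigMax [Nonempty ι] (hW : W.IsHermitian) : eigMin W ≤ eigMax W := by
  obtain ⟨r, hr⟩ := nonempty_spectrum hW
  exact (csInf_le (finite_spectrum hW).bddBelow hr).trans
    (le_csSup (finite_spectrum hW).bddAbove hr)

theorem eigMax_pos [Nonempty ι] (hW : W.PosDef) : 0 < eigMax W :=
  (eigMin_pos hW).trans_le (eigMin_le_eigMax hW.isHermitian)

theorem norm2_sq_le_wsq [Nonempty ι] (hW : W.PosDef) (x : ι → ℝ) :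
    norm2 x ^ 2 ≤ (eigMin W)⁻¹ * wsq W x := by
  rw [inv_mul_eq_div, le_div_iff₀ (eigMin_pos hW), mul_comm]
  exact eigMin_mul_le_wsq hW.isHermitian x

end Eigenvalues

/-! ### Open-loop trajectories and their costs -/

section Trajectories

variable {n m : ℕ} (A : Matrix (Fin n) (Fin n) ℝ) (B : Matrix (Fin n) (Fin m) ℝ)
  (Q : Matrix (Fin n) (Fin n) ℝ) (R : Matrix (Fin m) (Fin m) ℝ)

theorem stageCost_nonneg {Q : Matrix (Fin n) (Fin n) ℝ} {R : Matrix (Fin m) (Fin m) ℝ}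
    (hQ : Q.PosDef) (hR : R.PosDef) (x : Fin n → ℝ) (u : Fin m → ℝ) : 0 ≤ stageCost Q R x u :=
  add_nonneg (wsq_nonneg hQ.posSemidef x) (wsq_nonneg hR.posSemidef u)

theorem wsq_le_stageCost {R : Matrix (Fin m) (Fin m) ℝ}
    (hR : R.PosDef) (x : Fin n → ℝ) (u : Fin m → ℝ) : wsq Q x ≤ stageCost Q R x u :=
  le_add_of_nonneg_right (wsq_nonneg hR.posSemidef u)

theorem openLoop_congr (x : Fin n → ℝ) {u v : ℕ → Fin m → ℝ} {k : ℕ} (h : ∀ i < k, u i = v i) :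
    openLoop A B x u k = openLoop A B x v k := by
  induction k with
  | zero => rfl
  | succ k ih =>
    simp only [openLoop]
    rw [ih fun i hi => h i (hi.trans (Nat.lt_succ_self k)), h k (Nat.lt_succ_self k)]

theorem openLoop_add (x : Fin n → ℝ) (u : ℕ → Fin m → ℝ) (j k : ℕ) :
    openLoop A B x u (j + k) = openLoop A B (openLoop A B x u j) (fun i => u (j + i)) k := by
  induction k with
  | zero => rfl
  | succ k ih => rw [← add_assoc, openLoop, ih, openLoop]

/-- Two trajectories with the same inputs differ by the free evolution of the initial error. -/
theorem openLoop_add_state (x e : Fin n → ℝ) (u : ℕ → Fin m → ℝ) (k : ℕ) :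
    openLoop A B (x + e) u k = openLoop A B x u k + A ^ k *ᵥ e := by
  induction k with
  | zero => simp [openLoop]
  | succ k ih =>
    simp only [openLoop]
    rw [ih, Matrix.mulVec_add, pow_succ', ← Matrix.mulVec_mulVec]
    abel

theorem openLoop_midpoint (x : Fin n → ℝ) (u v : ℕ → Fin m → ℝ) (k : ℕ) :
    openLoop A B x (fun i => (1 / 2 : ℝ) • (u i + v i)) k =
      (1 / 2 : ℝ) • (openLoop A B x u k + openLoop A B x v k) := by
  induction k with
  | zero =>
    simp only [openLoop]
    rw [← two_smul ℝ x, smul_smul]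
    norm_num
  | succ k ih =>
    simp only [openLoop]
    rw [ih, Matrix.mulVec_smul, Matrix.mulVec_smul, Matrix.mulVec_add, Matrix.mulVec_add,
      ← smul_add]
    congr 1
    abel

theorem continuous_openLoop {X : Type*} [TopologicalSpace X] (x : Fin n → ℝ)
    (u : X → ℕ → Fin m → ℝ) (hu : ∀ k, Continuous fun a => u a k) (k : ℕ) :
    Continuous fun a => openLoop A B x (u a) k := by
  induction k with
  | zero => exact continuous_const
  | succ k ih =>
    have := hu k
    simp only [openLoop]
    fun_prop

/-- The cost `∑_{k < T} l(x_k, u_k)` of the first `T` stages of an infinite input sequence. -/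
def trajCost (x : Fin n → ℝ) (u : ℕ → Fin m → ℝ) (T : ℕ) : ℝ :=
  ∑ k ∈ Finset.range T, stageCost Q R (openLoop A B x u k) (u k)

theorem trajCost_add (x : Fin n → ℝ) (u : ℕ → Fin m → ℝ) (j T : ℕ) :
    trajCost A B Q R x u (j + T) = trajCost A B Q R x u j +
      trajCost A B Q R (openLoop A B x u j) (fun i => u (j + i)) T := by
  simp only [trajCost, Finset.sum_range_add, openLoop_add]

theorem trajCost_congr (x : Fin n → ℝ) {u v : ℕ → Fin m → ℝ} {T : ℕ} (h : ∀ i < T, u i = v i) :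
    trajCost A B Q R x u T = trajCost A B Q R x v T := by
  refine Finset.sum_congr rfl fun k hk => ?_
  have hk := Finset.mem_range.mp hk
  rw [openLoop_congr A B x fun i hi => h i (hi.trans hk), h k hk]

theorem extendInput_of_lt {N : ℕ} (u : Fin (N + 1) → Fin m → ℝ) (k : Fin (N + 1)) :
    extendInput u k = u k :=
  dif_pos k.isLt

theorem costN_eq_trajCost {N : ℕ} (x : Fin n → ℝ) (u : Fin (N + 1) → Fin m → ℝ) :
    costN A B Q R x u = trajCost A B Q R x (extendInput u) (N + 1) := by
  rw [trajCost, ← Fin.sum_univ_eq_sum_range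
    (fun k => stageCost Q R (openLoop A B x (extendInput u) k) (extendInput u k)), costN]
  simp only [extendInput_of_lt]

theorem costN_restrict_eq_trajCost {N : ℕ} (x : Fin n → ℝ) (u : ℕ → Fin m → ℝ) :
    costN A B Q R x (fun k : Fin (N + 1) => u k) = trajCost A B Q R x u (N + 1) := by
  rw [costN_eq_trajCost]
  refine trajCost_congr A B Q R x fun i hi => ?_
  simp [extendInput, hi]

end Trajectories

/-! ### The input polyhedron -/

section InputSet

variable {m c : ℕ} (F : Matrix (Fin c) (Fin m) ℝ)

theorem zero_mem_inputSet : (0 : Fin m → ℝ) ∈ inputSet F := by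
  intro i
  simp

theorem isClosed_inputSet : IsClosed (inputSet F) := by
  have : inputSet F = ⋂ i, {u | (F *ᵥ u) i ≤ 1} := by ext; simp [inputSet]
  rw [this]
  exact isClosed_iInter fun i => isClosed_le (by fun_prop) continuous_const

theorem isCompact_inputSet {F : Matrix (Fin c) (Fin m) ℝ}
    (hU : Bornology.IsBounded (inputSet F)) : IsCompact (inputSet F) :=
  Metric.isCompact_of_isClosed_isBounded (isClosed_inputSet F) hU

theorem midpoint_mem_inputSet {F : Matrix (Fin c) (Fin m) ℝ} {u v : Fin m → ℝ}
    (hu : u ∈ inputSet F) (hv : v ∈ inputSet F) : (1 / 2 : ℝ) • (u + v) ∈ inputSet F := by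
  intro i
  have h1 := hu i
  have h2 := hv i
  rw [Matrix.mulVec_smul, Matrix.mulVec_add]
  simp only [Pi.smul_apply, Pi.add_apply, smul_eq_mul]
  linarith

end InputSet

/-! ### Existence, uniqueness and the principle of optimality for the MPC problem -/

namespace Controller

variable {n m c : ℕ} {C : Controller n m c}

theorem exists_isOptimal (hU : Bornology.IsBounded (inputSet C.F)) (x : Fin n → ℝ) :
    ∃ u, C.IsOptimal x u := by
  have hK : IsCompact (Set.univ.pi fun _ : Fin (C.N + 1) => inputSet C.F) :=
    isCompact_univ_pi fun _ => isCompact_inputSet hU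
  have hcont : Continuous fun u : Fin (C.N + 1) → Fin m → ℝ => costN C.Ah C.Bh C.Q C.R x u := by
    simp only [costN, stageCost]
    refine continuous_finsetSum _ fun k _ => ?_
    refine ((continuous_wsq C.Q).comp (continuous_openLoop C.Ah C.Bh x _ (fun i => ?_) k)).add
      ((continuous_wsq C.R).comp (continuous_apply k))
    by_cases h : i < C.N + 1 <;> simp only [extendInput, h, dite_true, dite_false] <;> fun_prop
  obtain ⟨u, hu, hmin⟩ := hK.exists_isMinOn ⟨0, fun _ _ => zero_mem_inputSet C.F⟩ hcont.continuousOn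
  exact ⟨u, fun k => hu k trivial, fun v hv => hmin fun k _ => hv k⟩

theorem isOptimal_optInput (hU : Bornology.IsBounded (inputSet C.F)) (x : Fin n → ℝ) :
    C.IsOptimal x (C.optInput x) :=
  Classical.epsilon_spec (exists_isOptimal hU x)

/-- Trajectories are affine in the inputs, so the parallelogram identity applies stage by stage. The
convexity gain from the states is discarded; the gain from the inputs already forces uniqueness,
since `R` is definite. -/
theorem costN_midpoint_le (hQ : C.Q.PosDef) (x : Fin n → ℝ) (u v : Fin (C.N + 1) → Fin m → ℝ) :
    costN C.Ah C.Bh C.Q C.R x (fun k => (1 / 2 : ℝ) • (u k + v k)) ≤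
      (costN C.Ah C.Bh C.Q C.R x u + costN C.Ah C.Bh C.Q C.R x v) / 2 -
        ∑ k, wsq C.R (u k - v k) / 4 := by
  have hext : extendInput (fun k => (1 / 2 : ℝ) • (u k + v k)) =
      fun i => (1 / 2 : ℝ) • (extendInput u i + extendInput v i) := by
    funext i
    by_cases h : i < C.N + 1 <;> simp [extendInput, h]
  rw [costN, costN, costN, ← Finset.sum_add_distrib, Finset.sum_div, ← Finset.sum_sub_distrib]
  refine Finset.sum_le_sum fun k _ => ?_
  rw [hext, openLoop_midpoint]
  simp only [stageCost]
  rw [wsq_midpoint, wsq_midpoint]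
  have := wsq_nonneg hQ.posSemidef
    (openLoop C.Ah C.Bh x (extendInput u) k - openLoop C.Ah C.Bh x (extendInput v) k)
  linarith

theorem IsOptimal.unique (hQ : C.Q.PosDef) (hR : C.R.PosDef) {x : Fin n → ℝ}
    {u v : Fin (C.N + 1) → Fin m → ℝ} (hu : C.IsOptimal x u) (hv : C.IsOptimal x v) : u = v := by
  have h1 := hu.2 _ fun k => midpoint_mem_inputSet (hu.1 k) (hv.1 k)
  have h2 := hv.2 _ hu.1
  have h3 := costN_midpoint_le hQ x u v
  have h4 : ∑ k, wsq C.R (u k - v k) / 4 ≤ 0 := by linarith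
  have h5 : ∀ k ∈ Finset.univ, 0 ≤ wsq C.R (u k - v k) / 4 := fun k _ =>
    div_nonneg (wsq_nonneg hR.posSemidef _) (by norm_num)
  funext k
  have h6 := (Finset.single_le_sum h5 (Finset.mem_univ k)).trans h4
  exact sub_eq_zero.mp (eq_zero_of_wsq_nonpos hR (by linarith))

/-- The optimal input sequence, continued by zero. -/
def optSeq (C : Controller n m c) (x : Fin n → ℝ) : ℕ → Fin m → ℝ := extendInput (C.optInput x)

/-- The cost of the first `T` stages of the estimated model. -/
abbrev modelCost (C : Controller n m c) (x : Fin n → ℝ) (u : ℕ → Fin m → ℝ) (T : ℕ) : ℝ :=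
  trajCost C.Ah C.Bh C.Q C.R x u T

theorem optSeq_mem (hU : Bornology.IsBounded (inputSet C.F)) (x : Fin n → ℝ) (k : ℕ) :
    C.optSeq x k ∈ inputSet C.F := by
  by_cases h : k < C.N + 1
  · simpa [optSeq, extendInput, h] using (isOptimal_optInput hU x).1 ⟨k, h⟩
  · simpa [optSeq, extendInput, h] using zero_mem_inputSet C.F

theorem optSeq_zero (x : Fin n → ℝ) : C.optSeq x 0 = C.law x := by
  simp [optSeq, extendInput, law]

theorem value_eq (x : Fin n → ℝ) : C.value x = C.modelCost x (C.optSeq x) (C.N + 1) :=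
  costN_eq_trajCost _ _ _ _ _ _

theorem value_le (hU : Bornology.IsBounded (inputSet C.F)) (x : Fin n → ℝ) {v : ℕ → Fin m → ℝ}
    (hv : ∀ k, v k ∈ inputSet C.F) : C.value x ≤ C.modelCost x v (C.N + 1) := by
  rw [modelCost, ← costN_restrict_eq_trajCost]
  exact (isOptimal_optInput hU x).2 _ fun k => hv k

theorem modelCost_succ (x : Fin n → ℝ) (u : ℕ → Fin m → ℝ) (T : ℕ) :
    C.modelCost x u (T + 1) = stageCost C.Q C.R x (u 0) +
      C.modelCost (openLoop C.Ah C.Bh x u 1) (fun i => u (1 + i)) T := by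
  rw [add_comm T 1, modelCost, trajCost_add]
  simp [trajCost, openLoop]

theorem modelCost_nonneg (hQ : C.Q.PosDef) (hR : C.R.PosDef) (x : Fin n → ℝ)
    (u : ℕ → Fin m → ℝ) (T : ℕ) : 0 ≤ C.modelCost x u T :=
  Finset.sum_nonneg fun _ _ => stageCost_nonneg hQ hR _ _

theorem wsq_le_modelCost (hQ : C.Q.PosDef) (hR : C.R.PosDef) (x : Fin n → ℝ)
    (u : ℕ → Fin m → ℝ) (T : ℕ) : wsq C.Q x ≤ C.modelCost x u (T + 1) := by
  rw [modelCost_succ]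
  have := modelCost_nonneg hQ hR (openLoop C.Ah C.Bh x u 1) (fun i => u (1 + i)) T
  have := wsq_le_stageCost C.Q hR x (u 0)
  linarith

theorem wsq_le_value (hQ : C.Q.PosDef) (hR : C.R.PosDef) (x : Fin n → ℝ) :
    wsq C.Q x ≤ C.value x := by
  rw [value_eq]
  exact wsq_le_modelCost hQ hR x _ _

/-- The principle of optimality: tails of an optimal sequence are optimal. -/
theorem tail_le (hU : Bornology.IsBounded (inputSet C.F)) (x : Fin n → ℝ) {j T : ℕ}
    (hjT : j + T = C.N + 1) {w : ℕ → Fin m → ℝ} (hw : ∀ k, w k ∈ inputSet C.F) :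
    C.modelCost (openLoop C.Ah C.Bh x (C.optSeq x) j) (fun i => C.optSeq x (j + i)) T ≤
      C.modelCost (openLoop C.Ah C.Bh x (C.optSeq x) j) w T := by
  -- Splice the competitor `w` onto the first `j` optimal inputs; the common initial cost then
  -- cancels.
  set v : ℕ → Fin m → ℝ := fun k => if k < j then C.optSeq x k else w (k - j) with hv
  have h1 : C.value x ≤ C.modelCost x v (C.N + 1) := value_le hU x fun k => by
    by_cases h : k < j
    · simpa [hv, h] using optSeq_mem hU x k
    · simpa [hv, h] using hw (k - j)
  have h2 : ∀ i < j, v i = C.optSeq x i := fun i hi => by simp [hv, hi]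
  rw [value_eq, ← hjT, modelCost, trajCost_add, modelCost, trajCost_add, trajCost_congr _ _ _ _ x h2,
    openLoop_congr _ _ x h2] at h1
  have h3 : (fun i => v (j + i)) = w := by
    funext i
    simp [hv]
  rw [h3] at h1
  exact le_of_add_le_add_left h1

end Controller

/-! ### The linear feedback on the local region -/

section Local

variable {n m c : ℕ} {C : Controller n m c} {L : LocalData n m}

theorem openLoop_feedback (A : Matrix (Fin n) (Fin n) ℝ) (B : Matrix (Fin n) (Fin m) ℝ)
    (K : Matrix (Fin m) (Fin n) ℝ) (x : Fin n → ℝ) (k : ℕ) :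
    openLoop A B x (fun i => K *ᵥ ((A + B * K) ^ i *ᵥ x)) k = (A + B * K) ^ k *ᵥ x := by
  induction k with
  | zero => simp [openLoop]
  | succ k ih =>
    rw [openLoop, ih, pow_succ', ← Matrix.mulVec_mulVec, Matrix.add_mulVec,
      ← Matrix.mulVec_mulVec _ B K]

theorem one_le_ratioQ [Nonempty (Fin n)] (hQ : C.Q.PosDef) : 1 ≤ C.ratioQ := by
  rw [Controller.ratioQ, one_le_div (eigMin_pos hQ)]
  exact eigMin_le_eigMax hQ.isHermitian

variable [Nonempty (Fin n)] [Nonempty (Fin m)]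

theorem stageCost_feedback_le (hQ : C.Q.PosDef) (hR : C.R.PosDef) (K : Matrix (Fin m) (Fin n) ℝ)
    (x : Fin n → ℝ) : stageCost C.Q C.R x (K *ᵥ x) ≤
      (1 + (eigMin C.Q)⁻¹ * eigMax C.R * specNorm K ^ 2) * eigMax C.Q * norm2 x ^ 2 := by
  have h1 : wsq C.R (K *ᵥ x) ≤ eigMax C.R * (specNorm K ^ 2 * norm2 x ^ 2) := by
    refine (wsq_le_eigMax_mul hR.isHermitian _).trans
      (mul_le_mul_of_nonneg_left ?_ (eigMax_pos hR).le)
    rw [← mul_pow]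
    exact pow_le_pow_left₀ (norm2_nonneg _) (norm2_mulVec_le_specNorm K x) 2
  -- The input term is enlarged by the factor `r_Q ≥ 1`, so that `eigMax C.Q` factors out of both
  -- terms, as in the definition of `γ`.
  have h2 : eigMax C.R * (specNorm K ^ 2 * norm2 x ^ 2) ≤
      (eigMin C.Q)⁻¹ * eigMax C.R * specNorm K ^ 2 * (eigMax C.Q * norm2 x ^ 2) := by
    have h3 : 1 ≤ (eigMin C.Q)⁻¹ * eigMax C.Q := by
      rw [inv_mul_eq_div, one_le_div (eigMin_pos hQ)]
      exact eigMin_le_eigMax hQ.isHermitian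
    have h4 : 0 ≤ eigMax C.R * (specNorm K ^ 2 * norm2 x ^ 2) :=
      mul_nonneg (eigMax_pos hR).le (by positivity)
    nlinarith
  have h3 := wsq_le_eigMax_mul hQ.isHermitian x
  rw [stageCost]
  linarith

theorem LocalData.Admissible.one_lt_gam (hL : L.Admissible C) (hQ : C.Q.PosDef)
    (hR : C.R.PosDef) : 1 < C.gam L := by
  have h1 : 0 ≤ (eigMin C.Q)⁻¹ * eigMax C.R * specNorm L.K ^ 2 :=
    mul_nonneg (mul_nonneg (inv_nonneg.mpr (eigMin_pos hQ).le) (eigMax_pos hR).le) (sq_nonneg _)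
  have h2 : 1 ≤ C.cStar L :=
    one_le_mul_of_one_le_of_one_le
      (one_le_mul_of_one_le_of_one_le (by linarith) (one_le_ratioQ hQ))
      (one_le_pow₀ hL.one_le_lam)
  have := hL.rho_pos
  have := hL.rho_lt_one
  rw [Controller.gam, one_lt_div (by linarith)]
  linarith

/-- On the local region the linear law has cost at most `γ ‖x‖²_Q`, over every horizon. -/
theorem LocalData.Admissible.modelCost_le (hL : L.Admissible C) (hQ : C.Q.PosDef)
    (hR : C.R.PosDef) (x : Fin n → ℝ) (T : ℕ) :
    C.modelCost x (fun i => L.K *ᵥ ((C.Ah + C.Bh * L.K) ^ i *ᵥ x)) T ≤ C.gam L * wsq C.Q x := by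
  set D := (1 + (eigMin C.Q)⁻¹ * eigMax C.R * specNorm L.K ^ 2) * eigMax C.Q with hD
  have hD0 : 0 ≤ D := by
    have h1 : 0 ≤ (eigMin C.Q)⁻¹ * eigMax C.R * specNorm L.K ^ 2 :=
      mul_nonneg (mul_nonneg (inv_nonneg.mpr (eigMin_pos hQ).le) (eigMax_pos hR).le) (sq_nonneg _)
    exact mul_nonneg (by linarith) (eigMax_pos hQ).le
  have h1 : ∀ k ∈ Finset.range T,
      stageCost C.Q C.R (openLoop C.Ah C.Bh x
        (fun i => L.K *ᵥ ((C.Ah + C.Bh * L.K) ^ i *ᵥ x)) k)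
        (L.K *ᵥ ((C.Ah + C.Bh * L.K) ^ k *ᵥ x)) ≤ D * L.lam ^ 2 * norm2 x ^ 2 * L.rho ^ k := by
    intro k _
    rw [openLoop_feedback]
    refine (stageCost_feedback_le hQ hR L.K _).trans ?_
    have h2 : norm2 ((C.Ah + C.Bh * L.K) ^ k *ᵥ x) ≤ L.lam * √L.rho ^ k * norm2 x :=
      (norm2_mulVec_le_specNorm _ _).trans
        (mul_le_mul_of_nonneg_right (hL.decay k) (norm2_nonneg _))
    have h3 := pow_le_pow_left₀ (norm2_nonneg _) h2 2
    have h4 : (√L.rho ^ k) ^ 2 = L.rho ^ k := by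
      rw [← pow_mul, mul_comm, pow_mul, Real.sq_sqrt hL.rho_pos.le]
    rw [mul_pow, mul_pow, h4] at h3
    calc _ ≤ D * (L.lam ^ 2 * L.rho ^ k * norm2 x ^ 2) := mul_le_mul_of_nonneg_left h3 hD0
      _ = _ := by ring
  have h2 : ∑ k ∈ Finset.range T, L.rho ^ k ≤ (1 - L.rho)⁻¹ := by
    rw [← tsum_geometric_of_lt_one hL.rho_pos.le hL.rho_lt_one]
    exact (summable_geometric_of_lt_one hL.rho_pos.le hL.rho_lt_one).sum_le_tsum _
      fun k _ => pow_nonneg hL.rho_pos.le k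
  have h3 : 0 ≤ (1 - L.rho)⁻¹ := inv_nonneg.mpr (by linarith [hL.rho_lt_one])
  calc _ ≤ ∑ k ∈ Finset.range T, D * L.lam ^ 2 * norm2 x ^ 2 * L.rho ^ k := Finset.sum_le_sum h1
    _ ≤ D * L.lam ^ 2 * norm2 x ^ 2 * (1 - L.rho)⁻¹ := by
      rw [← Finset.mul_sum]
      exact mul_le_mul_of_nonneg_left h2 (by positivity)
    _ ≤ D * L.lam ^ 2 * ((eigMin C.Q)⁻¹ * wsq C.Q x) * (1 - L.rho)⁻¹ := by
      have := norm2_sq_le_wsq hQ x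
      gcongr
    _ = C.gam L * wsq C.Q x := by
      rw [Controller.gam, Controller.cStar, Controller.ratioQ, hD]
      ring

end Local

/-! ### Decay of the cost-to-go along an optimal prediction -/

section TailDecay

/-- A cost-to-go sequence `W` with stage costs at least `s` that is locally bounded by `γ s`
contracts to a small multiple of `s 0`. -/
theorem tail_decay {W s : ℕ → ℝ} {γ ε M : ℝ} {N N₀ : ℕ} (hγ : 1 < γ) (hε : 0 < ε)
    (hstep : ∀ j < N, W (j + 1) ≤ W j - s j) (hs : ∀ j ≤ N, 0 ≤ s j)
    (hloc : ∀ j ≤ N, s j ≤ ε → W j ≤ γ * s j) (hM : W 0 ≤ M) (hN₀ : M ≤ (N₀ + γ) * ε) :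
    W N ≤ γ * ((γ - 1) / γ) ^ ((N : ℤ) - (N₀ : ℤ)) * s 0 := by
  have hγ0 : 0 < γ := one_pos.trans hγ
  have hρ : 0 < (γ - 1) / γ := div_pos (by linarith) hγ0
  have hρ1 : (γ - 1) / γ = 1 - 1 / γ := by field_simp
  -- Each step with `s j > ε` lowers `W` by at least `ε`. A step with `s j ≤ ε` brings it below `γ
  -- ε` at once, and `W` never rises again.
  have h1 : ∀ j ≤ N, W j ≤ max (M - j * ε) (γ * ε) := by
    intro j
    induction j with
    | zero => intro _; simp [hM]
    | succ j ih =>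
      intro hj
      have ih := ih (by omega)
      have hst := hstep j (by omega)
      have hsj := hs j (by omega)
      by_cases h : s j ≤ ε
      · have := hloc j (by omega) h
        refine le_max_of_le_right ?_
        nlinarith
      · rcases le_max_iff.mp ih with h2 | h2
        · refine le_max_of_le_left ?_
          push_cast
          linarith
        · exact le_max_of_le_right (by linarith)
  have h2 : ∀ j ≤ N, W j ≤ W 0 := by
    intro j
    induction j with
    | zero => intro _; exact le_rfl
    | succ j ih =>
      intro hj
      linarith [ih (by omega), hstep j (by omega), hs j (by omega)]
  rcases le_or_gt N₀ N with hN | hN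
  · have h3 : ∀ j ≤ N, N₀ ≤ j → W j ≤ γ * ε := fun j hj hj0 => by
      have : (N₀ : ℝ) ≤ j := by exact_mod_cast hj0
      refine (h1 j hj).trans (max_le ?_ le_rfl)
      nlinarith
    -- From `N₀` on, `W ≤ γ s` holds in both cases: by `hloc` when `s ≤ ε`, and from `W ≤ γ ε < γ s`
    -- otherwise. Hence each step contracts by `1 - 1/γ`. The same dichotomy on `s 0` starts the
    -- induction.
    have h4 : ∀ i, N₀ + i ≤ N → W (N₀ + i) ≤ γ * ((γ - 1) / γ) ^ i * s 0 := by
      intro i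
      induction i with
      | zero =>
        intro hi
        simp only [add_zero, pow_zero, mul_one]
        by_cases h : s 0 ≤ ε
        · exact (h2 _ hN).trans (hloc 0 (Nat.zero_le _) h)
        · have := h3 N₀ hN le_rfl
          nlinarith
      | succ i ih =>
        intro hi
        have ih := ih (by omega)
        have hst := hstep (N₀ + i) (by omega)
        have h5 : W (N₀ + i) ≤ γ * s (N₀ + i) := by
          by_cases h : s (N₀ + i) ≤ ε
          · exact hloc _ (by omega) h
          · have := h3 (N₀ + i) (by omega) (by omega)
            nlinarith
        have h6 : W (N₀ + i) / γ ≤ s (N₀ + i) := by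
          rw [div_le_iff₀ hγ0]
          linarith
        calc W (N₀ + (i + 1)) ≤ W (N₀ + i) - s (N₀ + i) := hst
          _ ≤ (γ - 1) / γ * W (N₀ + i) := by
            rw [hρ1]
            have : W (N₀ + i) / γ = 1 / γ * W (N₀ + i) := by ring
            linarith
          _ ≤ (γ - 1) / γ * (γ * ((γ - 1) / γ) ^ i * s 0) := mul_le_mul_of_nonneg_left ih hρ.le
          _ = _ := by ring
    obtain ⟨i, rfl⟩ := Nat.exists_eq_add_of_le hN
    have h5 := h4 i le_rfl
    have h6 : ((N₀ + i : ℕ) : ℤ) - (N₀ : ℤ) = (i : ℤ) := by push_cast; ring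
    rw [h6, zpow_natCast]
    exact h5
  -- For a horizon shorter than `N₀` the exponent is `-k`, and the factor exceeds one. Bernoulli's
  -- inequality shows that it dominates the linear bound `W N ≤ (γ + k) ε`.
  · obtain ⟨k, rfl⟩ := Nat.exists_eq_add_of_le hN.le
    have h6 : (N : ℤ) - ((N + k : ℕ) : ℤ) = -(k : ℤ) := by push_cast; ring
    rw [h6, zpow_neg, zpow_natCast, ← inv_pow, inv_div]
    have h7 : 1 + (k : ℝ) * (1 / (γ - 1)) ≤ (γ / (γ - 1)) ^ k := by
      have h8 : γ / (γ - 1) = 1 + 1 / (γ - 1) := by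
        have : γ - 1 ≠ 0 := by linarith
        field_simp
        ring
      have : 0 ≤ 1 / (γ - 1) := one_div_nonneg.mpr (by linarith)
      rw [h8]
      exact one_add_mul_le_pow (by linarith) k
    have h8 : 1 / γ ≤ 1 / (γ - 1) := one_div_le_one_div_of_le (by linarith) (by linarith)
    have h9 : (k : ℝ) * (1 / γ) ≤ k * (1 / (γ - 1)) :=
      mul_le_mul_of_nonneg_left h8 (Nat.cast_nonneg k)
    have h10 : γ + k ≤ γ * (γ / (γ - 1)) ^ k := by
      calc γ + k = γ * (1 + k * (1 / γ)) := by field_simp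
        _ ≤ _ := mul_le_mul_of_nonneg_left (by linarith) hγ0.le
    have hk : (0 : ℝ) ≤ k := Nat.cast_nonneg k
    have hs0 := hs 0 (Nat.zero_le _)
    by_cases h : s 0 ≤ ε
    · calc W N ≤ γ * s 0 := (h2 N le_rfl).trans (hloc 0 (Nat.zero_le _) h)
        _ ≤ _ := mul_le_mul_of_nonneg_right (by linarith) hs0
    · have h11 : W N ≤ (γ + k) * ε := by
        refine (h1 N le_rfl).trans (max_le ?_ ?_)
        · push_cast at hN₀
          linarith
        · nlinarith
      calc W N ≤ (γ + k) * ε := h11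
        _ ≤ (γ + k) * s 0 := mul_le_mul_of_nonneg_left (by linarith) (by linarith)
        _ ≤ _ := mul_le_mul_of_nonneg_right h10 hs0

end TailDecay

/-! ### Descent of the value function along the true closed loop -/

section Descent

variable {n m c : ℕ} {C : Controller n m c} {L : LocalData n m}

/-- The level up to which the descent of the value function is guaranteed. -/
def descentLevel (C : Controller n m c) (L : LocalData n m) : ℝ := max L.M (C.gam L * L.eps)

/-- Raising the level from `M` to `max M (γ ε)` needs no new constants: `L_V̂ ε` already equals this
maximum, and `(N₀ + γ) ε` is at least as large. The raised level contains a neighbourhood of the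
origin whatever `M` is, which Lyapunov stability requires. -/
theorem descentLevel_le_lV_mul (hε : 0 < L.eps) : descentLevel C L ≤ C.lV L * L.eps := by
  refine max_le ?_ (mul_le_mul_of_nonneg_right (le_max_left _ _) hε.le)
  exact (div_mul_cancel₀ L.M hε.ne').symm.le.trans
    (mul_le_mul_of_nonneg_right (le_max_right _ _) hε.le)

theorem descentLevel_le_horizon0 (hε : 0 < L.eps) :
    descentLevel C L ≤ ((C.horizon0 L : ℝ) + C.gam L) * L.eps := by
  have h := Nat.le_ceil (max 0 ((L.M - C.gam L * L.eps) / L.eps))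
  have h1 := (le_max_left _ _).trans h
  have h2 := (le_max_right _ _).trans h
  rw [div_le_iff₀ hε] at h2
  rw [Controller.horizon0, add_mul]
  refine max_le (by linarith) (le_add_of_nonneg_left (mul_nonneg h1 hε.le))

variable [Nonempty (Fin n)] [Nonempty (Fin m)]

theorem LocalData.Admissible.tailFactor_nonneg (hL : L.Admissible C) (hQ : C.Q.PosDef)
    (hR : C.R.PosDef) : 0 ≤ C.tailFactor L := by
  have := hL.one_lt_gam hQ hR
  rw [Controller.tailFactor, Controller.rhoGam]
  exact mul_nonneg (by linarith) (zpow_nonneg (div_nonneg (by linarith) (by linarith)) _)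

theorem LocalData.Admissible.modelCost_tail_le (hL : L.Admissible C) (hQ : C.Q.PosDef)
    (hR : C.R.PosDef) (hU : Bornology.IsBounded (inputSet C.F)) (x : Fin n → ℝ) {j T : ℕ}
    (hjT : j + T = C.N + 1) (hx : wsq C.Q (openLoop C.Ah C.Bh x (C.optSeq x) j) ≤ L.eps) :
    C.modelCost (openLoop C.Ah C.Bh x (C.optSeq x) j) (fun i => C.optSeq x (j + i)) T ≤
      C.gam L * wsq C.Q (openLoop C.Ah C.Bh x (C.optSeq x) j) :=
  (Controller.tail_le hU x hjT fun k => hL.feasible _ hx k).trans (hL.modelCost_le hQ hR _ _)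

theorem LocalData.Admissible.value_le_of_local (hL : L.Admissible C) (hQ : C.Q.PosDef)
    (hR : C.R.PosDef) (hU : Bornology.IsBounded (inputSet C.F)) {x : Fin n → ℝ}
    (hx : wsq C.Q x ≤ L.eps) : C.value x ≤ C.gam L * wsq C.Q x :=
  (Controller.value_le hU x fun k => hL.feasible _ hx k).trans (hL.modelCost_le hQ hR _ _)

/-- Locally the linear law gives the factor `γ`; elsewhere `‖x‖²_Q > ε`, so the level itself is at
most `L_V̂ ‖x‖²_Q`. -/
theorem LocalData.Admissible.value_le_lV (hL : L.Admissible C) (hQ : C.Q.PosDef)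
    (hR : C.R.PosDef) (hU : Bornology.IsBounded (inputSet C.F)) {x : Fin n → ℝ}
    (hx : C.value x ≤ descentLevel C L) : C.value x ≤ C.lV L * wsq C.Q x := by
  have hγ := hL.one_lt_gam hQ hR
  have hlV : C.gam L ≤ C.lV L := le_max_left _ _
  by_cases h : wsq C.Q x ≤ L.eps
  · exact (hL.value_le_of_local hQ hR hU h).trans
      (mul_le_mul_of_nonneg_right hlV (wsq_nonneg hQ.posSemidef x))
  · exact (hx.trans (descentLevel_le_lV_mul hL.eps_pos)).trans
      (mul_le_mul_of_nonneg_left (le_of_not_ge h) (by linarith))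

/-- The terminal predicted state is small compared with the initial one. -/
theorem LocalData.Admissible.wsq_terminal_le (hL : L.Admissible C) (hQ : C.Q.PosDef)
    (hR : C.R.PosDef) (hU : Bornology.IsBounded (inputSet C.F)) {x : Fin n → ℝ}
    (hx : C.value x ≤ descentLevel C L) :
    wsq C.Q (openLoop C.Ah C.Bh x (C.optSeq x) C.N) ≤ C.tailFactor L * wsq C.Q x := by
  set u := C.optSeq x with hu
  set s : ℕ → ℝ := fun j => wsq C.Q (openLoop C.Ah C.Bh x u j) with hs
  -- The cost-to-go at stage `j` covers `C.N + 1 - j` stages, so one stage remains at `j = C.N` and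
  -- it dominates the terminal `‖·‖²_Q`.
  set W : ℕ → ℝ := fun j =>
    C.modelCost (openLoop C.Ah C.Bh x u j) (fun i => u (j + i)) (C.N + 1 - j) with hW
  have hsW : s C.N ≤ W C.N := by
    simp only [hW, hs, Nat.add_sub_cancel_left]
    exact Controller.wsq_le_modelCost hQ hR _ _ 0
  refine hsW.trans (tail_decay (s := s) (ε := L.eps) (M := descentLevel C L)
    (hL.one_lt_gam hQ hR) hL.eps_pos (fun j hj => ?_) (fun j _ => wsq_nonneg hQ.posSemidef _)
    (fun j hj h => hL.modelCost_tail_le hQ hR hU x (by omega) h) ?_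
    (descentLevel_le_horizon0 hL.eps_pos))
  · have h1 : C.N + 1 - j = (C.N + 1 - (j + 1)) + 1 := by omega
    simp only [hW, hs]
    rw [h1, Controller.modelCost_succ, ← openLoop_add]
    have := wsq_le_stageCost C.Q hR (openLoop C.Ah C.Bh x u j) (u (j + 0))
    simp only [add_assoc] at this ⊢
    linarith
  · have : W 0 = C.value x := by
      simp only [hW, Controller.value_eq, openLoop, Nat.sub_zero, zero_add]
      rfl
    rwa [this]

omit [Nonempty (Fin m)] in
theorem wsq_mulVec_le (hQ : C.Q.PosDef) (M : Matrix (Fin n) (Fin n) ℝ) (x : Fin n → ℝ) :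
    wsq C.Q (M *ᵥ x) ≤ specNorm M ^ 2 * C.ratioQ * wsq C.Q x := by
  have h1 := wsq_le_eigMax_mul hQ.isHermitian (M *ᵥ x)
  have h2 := pow_le_pow_left₀ (norm2_nonneg _) (norm2_mulVec_le_specNorm M x) 2
  have h3 := norm2_sq_le_wsq hQ x
  have h4 := eigMax_pos hQ
  calc wsq C.Q (M *ᵥ x) ≤ eigMax C.Q * (specNorm M * norm2 x) ^ 2 :=
        h1.trans (mul_le_mul_of_nonneg_left h2 h4.le)
    _ = eigMax C.Q * specNorm M ^ 2 * norm2 x ^ 2 := by ring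
    _ ≤ eigMax C.Q * specNorm M ^ 2 * ((eigMin C.Q)⁻¹ * wsq C.Q x) :=
        mul_le_mul_of_nonneg_left h3 (by positivity)
    _ = _ := by rw [Controller.ratioQ]; ring

omit [Nonempty (Fin m)] in
theorem wsq_pow_mulVec_le (hQ : C.Q.PosDef) (M : Matrix (Fin n) (Fin n) ℝ) (x : Fin n → ℝ)
    (k : ℕ) {E : ℝ} (hx : norm2 x ^ 2 ≤ E) :
    wsq C.Q (M ^ k *ᵥ x) ≤ eigMax C.Q * ((specNorm M ^ 2) ^ k * E) := by
  refine (wsq_le_eigMax_mul hQ.isHermitian _).trans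
    (mul_le_mul_of_nonneg_left ?_ (eigMax_pos hQ).le)
  have := pow_le_pow_left₀ (norm2_nonneg _) (norm2_pow_mulVec_le M x k) 2
  calc _ ≤ _ := this
    _ = (specNorm M ^ 2) ^ k * norm2 x ^ 2 := by ring
    _ ≤ _ := mul_le_mul_of_nonneg_left hx (by positivity)

/-- The one-step prediction error is bounded by the stage cost. -/
theorem norm2_modelError_sq_le (hQ : C.Q.PosDef) (hR : C.R.PosDef)
    {A : Matrix (Fin n) (Fin n) ℝ} {B : Matrix (Fin n) (Fin m) ℝ} {δA δB : ℝ}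
    (hA : frobNorm (C.Ah - A) ≤ δA) (hB : frobNorm (C.Bh - B) ≤ δB)
    (x : Fin n → ℝ) (u : Fin m → ℝ) :
    norm2 ((A *ᵥ x + B *ᵥ u) - (C.Ah *ᵥ x + C.Bh *ᵥ u)) ^ 2 ≤
      C.hErr δA δB * stageCost C.Q C.R x u := by
  have h0 : (A *ᵥ x + B *ᵥ u) - (C.Ah *ᵥ x + C.Bh *ᵥ u) =
      -((C.Ah - A) *ᵥ x + (C.Bh - B) *ᵥ u) := by
    rw [Matrix.sub_mulVec, Matrix.sub_mulVec]
    abel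
  have h1 : norm2 ((C.Ah - A) *ᵥ x + (C.Bh - B) *ᵥ u) ≤ δA * norm2 x + δB * norm2 u :=
    (norm2_add_le _ _).trans (add_le_add
      ((norm2_mulVec_le_frobNorm _ _).trans (mul_le_mul_of_nonneg_right hA (norm2_nonneg _)))
      ((norm2_mulVec_le_frobNorm _ _).trans (mul_le_mul_of_nonneg_right hB (norm2_nonneg _))))
  have hq := eigMin_pos hQ
  have hr := eigMin_pos hR
  have h3 := eigMin_mul_le_wsq hQ.isHermitian x
  have h4 := eigMin_mul_le_wsq hR.isHermitian u
  have hh : 0 ≤ C.hErr δA δB := by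
    rw [Controller.hErr]
    positivity
  rw [h0, norm2_neg]
  calc _ ≤ (δA * norm2 x + δB * norm2 u) ^ 2 := pow_le_pow_left₀ (norm2_nonneg _) h1 2
    _ ≤ C.hErr δA δB * (eigMin C.Q * norm2 x ^ 2 + eigMin C.R * norm2 u ^ 2) := by
      rw [Controller.hErr]
      set a := eigMin C.Q
      set b := eigMin C.R
      -- Lagrange's identity: the defect in the weighted Cauchy–Schwarz inequality is a square.
      have h5 : (a⁻¹ * δA ^ 2 + b⁻¹ * δB ^ 2) * (a * norm2 x ^ 2 + b * norm2 u ^ 2) -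
          (δA * norm2 x + δB * norm2 u) ^ 2 =
          a⁻¹ * b⁻¹ * (δA * b * norm2 u - δB * a * norm2 x) ^ 2 := by
        field_simp
        ring
      have : 0 ≤ a⁻¹ * b⁻¹ * (δA * b * norm2 u - δB * a * norm2 x) ^ 2 := by positivity
      linarith
    _ ≤ _ := by
      rw [stageCost]
      exact mul_le_mul_of_nonneg_left (add_le_add h3 h4) hh

/-- The descent of the value function along the true closed loop. -/
theorem LocalData.Admissible.value_step_le (hL : L.Admissible C) (hQ : C.Q.PosDef)
    (hR : C.R.PosDef) (hU : Bornology.IsBounded (inputSet C.F)) (hN : 1 ≤ C.N)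
    {A : Matrix (Fin n) (Fin n) ℝ} {B : Matrix (Fin n) (Fin m) ℝ} {δA δB : ℝ}
    (hA : frobNorm (C.Ah - A) ≤ δA) (hB : frobNorm (C.Bh - B) ≤ δB) {x : Fin n → ℝ}
    (hx : C.value x ≤ descentLevel C L) :
    C.value (A *ᵥ x + B *ᵥ C.law x) ≤
      C.value x - (1 - C.xi L δA δB - C.eta L) * stageCost C.Q C.R x (C.law x) := by
  obtain ⟨N, hN'⟩ := Nat.exists_eq_add_of_le' hN
  set u := C.optSeq x with hu
  have hu0 : u 0 = C.law x := Controller.optSeq_zero x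
  set l := stageCost C.Q C.R x (C.law x) with hl
  set x₁ := openLoop C.Ah C.Bh x u 1 with hx₁
  set w : ℕ → Fin m → ℝ := fun i => u (1 + i) with hw
  set e := (A *ᵥ x + B *ᵥ C.law x) - (C.Ah *ᵥ x + C.Bh *ᵥ C.law x) with he
  -- With `C.N = N + 1` the candidate has `N + 2` stages: the shifted inputs `u 1, …, u N`, then two
  -- zeros. The last optimal input is dropped, and the zeros carry no input cost and are always
  -- admissible.
  set v : ℕ → Fin m → ℝ := fun k => if k < N then w k else 0 with hv
  have hl0 : 0 ≤ l := stageCost_nonneg hQ hR _ _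
  have hQl : wsq C.Q x ≤ l := wsq_le_stageCost C.Q hR _ _
  have hxe : A *ᵥ x + B *ᵥ C.law x = x₁ + e := by
    simp only [hx₁, openLoop, hu0, he]
    abel
  have hh : 0 ≤ C.hErr δA δB := by
    have := eigMin_pos hQ
    have := eigMin_pos hR
    rw [Controller.hErr]
    positivity
  have hE : norm2 e ^ 2 ≤ C.hErr δA δB * l := norm2_modelError_sq_le hQ hR hA hB x _
  set E := C.hErr δA δB * l with hE'
  have hE0 : 0 ≤ E := mul_nonneg hh hl0
  set z := openLoop C.Ah C.Bh (x₁ + e) v with hz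
  have hz1 : ∀ k ≤ N, z k = openLoop C.Ah C.Bh x₁ w k + C.Ah ^ k *ᵥ e := fun k hk => by
    rw [hz, openLoop_add_state, openLoop_congr _ _ _ fun i hi => ?_]
    simp [hv, hi.trans_le hk]
  -- the cost of the shifted candidate sequence
  have hcand : C.value (x₁ + e) ≤ (∑ k ∈ Finset.range N, wsq C.Q (z k)) +
      (∑ k ∈ Finset.range N, wsq C.R (w k)) + wsq C.Q (z N) + wsq C.Q (z (N + 1)) := by
    have h1 : C.value (x₁ + e) ≤ C.modelCost (x₁ + e) v (C.N + 1) :=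
      Controller.value_le hU _ fun k => by
        by_cases h : k < N
        · simpa [hv, h, hw] using Controller.optSeq_mem hU x (1 + k)
        · simpa [hv, h] using zero_mem_inputSet C.F
    rw [hN', Controller.modelCost, trajCost, Finset.sum_range_succ, Finset.sum_range_succ] at h1
    have h2 : ∑ k ∈ Finset.range N, stageCost C.Q C.R (openLoop C.Ah C.Bh (x₁ + e) v k) (v k) =
        (∑ k ∈ Finset.range N, wsq C.Q (z k)) + ∑ k ∈ Finset.range N, wsq C.R (w k) := by
      rw [← Finset.sum_add_distrib]
      refine Finset.sum_congr rfl fun k hk => ?_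
      simp [stageCost, hv, Finset.mem_range.mp hk, hz]
    have h3 : v N = 0 := by simp [hv]
    have h4 : v (N + 1) = 0 := by simp [hv]
    rw [h2, h3, h4, stageCost, stageCost, wsq_zero] at h1
    linarith
  have hzlast : wsq C.Q (z (N + 1)) ≤ specNorm C.Ah ^ 2 * C.ratioQ * wsq C.Q (z N) := by
    have : z (N + 1) = C.Ah *ᵥ z N := by simp [hz, openLoop, hv]
    rw [this]
    exact wsq_mulVec_le hQ C.Ah (z N)
  -- the nominal cost
  have hnom : l + ((∑ k ∈ Finset.range N, wsq C.Q (openLoop C.Ah C.Bh x₁ w k)) +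
      ∑ k ∈ Finset.range N, wsq C.R (w k)) + wsq C.Q (openLoop C.Ah C.Bh x₁ w N) ≤ C.value x := by
    rw [Controller.value_eq, hN', Controller.modelCost_succ, Controller.modelCost, trajCost,
      Finset.sum_range_succ, ← Finset.sum_add_distrib, Controller.optSeq_zero]
    have := wsq_le_stageCost C.Q hR (openLoop C.Ah C.Bh x₁ w N) (w N)
    simp only [stageCost] at this ⊢
    simp only [hl, stageCost]
    linarith
  have hR0 : 0 ≤ ∑ k ∈ Finset.range N, wsq C.R (w k) :=
    Finset.sum_nonneg fun k _ => wsq_nonneg hR.posSemidef _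
  have hlV : 1 ≤ C.lV L := (hL.one_lt_gam hQ hR).le.trans (le_max_left _ _)
  -- The value is at most `L_V̂ l`, and the first stage accounts for one `l`.
  have hSl : ∑ k ∈ Finset.range N, wsq C.Q (openLoop C.Ah C.Bh x₁ w k) ≤ (C.lV L - 1) * l := by
    have h1 := hL.value_le_lV hQ hR hU hx
    have h2 : C.lV L * wsq C.Q x ≤ C.lV L * l := mul_le_mul_of_nonneg_left hQl (by linarith)
    have h3 := wsq_nonneg hQ.posSemidef (openLoop C.Ah C.Bh x₁ w N)
    linarith
  have hGE : ∑ k ∈ Finset.range N, wsq C.Q (C.Ah ^ k *ᵥ e) ≤ eigMax C.Q * (C.geomSum * E) := by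
    rw [Controller.geomSum, hN', Nat.add_sub_cancel, Finset.sum_mul, Finset.mul_sum]
    exact Finset.sum_le_sum fun k _ => wsq_pow_mulVec_le hQ C.Ah e k hE
  have hterm : wsq C.Q (openLoop C.Ah C.Bh x₁ w N) ≤ C.tailFactor L * l := by
    have h1 := hL.wsq_terminal_le hQ hR hU hx
    have h2 : openLoop C.Ah C.Bh x (C.optSeq x) C.N = openLoop C.Ah C.Bh x₁ w N := by
      rw [hN', add_comm N 1, openLoop_add]
    rw [h2] at h1
    exact h1.trans (mul_le_mul_of_nonneg_left hQl (hL.tailFactor_nonneg hQ hR))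
  -- the perturbed sums
  have hsum : ∑ k ∈ Finset.range N, wsq C.Q (z k) ≤
      (∑ k ∈ Finset.range N, wsq C.Q (openLoop C.Ah C.Bh x₁ w k)) +
        2 * (√((C.lV L - 1) * l) * √(eigMax C.Q * (C.geomSum * E))) +
        eigMax C.Q * (C.geomSum * E) := by
    rw [Finset.sum_congr rfl fun k hk => by rw [hz1 k (Finset.mem_range.mp hk).le]]
    exact sum_wsq_add_le hQ.posSemidef _ _ _ hSl hGE
  have hzN : wsq C.Q (z N) ≤ wsq C.Q (openLoop C.Ah C.Bh x₁ w N) +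
      2 * (√(C.tailFactor L * l) * √(eigMax C.Q * ((specNorm C.Ah ^ 2) ^ N * E))) +
      eigMax C.Q * ((specNorm C.Ah ^ 2) ^ N * E) := by
    rw [hz1 N le_rfl]
    exact wsq_add_le hQ.posSemidef _ _ hterm (wsq_pow_mulVec_le hQ C.Ah e N hE)
  have hq := eigMax_pos hQ
  have hG0 : 0 ≤ C.geomSum := Finset.sum_nonneg fun i _ => by positivity
  have hτ0 : 0 ≤ C.tailFactor L := hL.tailFactor_nonneg hQ hR
  -- Both radicands are multiples of `l`, so the cross term is linear in `l`; this is where the `√h`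
  -- part of `ξ_N` comes from.
  have hr1 : √((C.lV L - 1) * l) * √(eigMax C.Q * (C.geomSum * E)) =
      √(eigMax C.Q * (C.lV L - 1) * C.geomSum) * √(C.hErr δA δB) * l := by
    rw [← Real.sqrt_mul (mul_nonneg (by linarith) hl0),
      ← Real.sqrt_mul (mul_nonneg (mul_nonneg hq.le (by linarith)) hG0), hE']
    rw [show (C.lV L - 1) * l * (eigMax C.Q * (C.geomSum * (C.hErr δA δB * l))) =
      eigMax C.Q * (C.lV L - 1) * C.geomSum * C.hErr δA δB * l ^ 2 by ring,
      Real.sqrt_mul' _ (sq_nonneg l), Real.sqrt_sq hl0]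
  have hr2 : √(C.tailFactor L * l) * √(eigMax C.Q * ((specNorm C.Ah ^ 2) ^ N * E)) =
      √(eigMax C.Q * (specNorm C.Ah ^ 2) ^ N * C.tailFactor L) * √(C.hErr δA δB) * l := by
    rw [← Real.sqrt_mul (mul_nonneg hτ0 hl0),
      ← Real.sqrt_mul (by positivity), hE']
    rw [show C.tailFactor L * l * (eigMax C.Q * ((specNorm C.Ah ^ 2) ^ N *
        (C.hErr δA δB * l))) =
      eigMax C.Q * (specNorm C.Ah ^ 2) ^ N * C.tailFactor L * C.hErr δA δB * l ^ 2 by ring,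
      Real.sqrt_mul' _ (sq_nonneg l), Real.sqrt_sq hl0]
  rw [hr1] at hsum
  rw [hr2] at hzN
  rw [hxe]
  have hc : 0 ≤ specNorm C.Ah ^ 2 * C.ratioQ :=
    mul_nonneg (sq_nonneg _) (zero_le_one.trans (one_le_ratioQ hQ))
  -- The state `z N` is charged twice: as a stage, and through its successor `Â z N`. The first copy
  -- of its nominal part cancels against `hnom`; the second, bounded by `hterm'`, produces `η_N`.
  have hzN' := mul_le_mul_of_nonneg_left hzN (a := 1 + specNorm C.Ah ^ 2 * C.ratioQ)
    (by linarith)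
  have hterm' := mul_le_mul_of_nonneg_left hterm hc
  rw [Controller.xi, Controller.omegaOne, Controller.omegaHalf, Controller.eta, hN',
    Nat.add_sub_cancel]
  rw [hE'] at hsum hzN'
  linarith

end Descent

/-! ### Comparison of estimated and true open-loop costs -/

section Perturbation

variable {n m c : ℕ} {C : Controller n m c} {A : Matrix (Fin n) (Fin n) ℝ}
  {B : Matrix (Fin n) (Fin m) ℝ} {δA δB : ℝ}

/-- The Frobenius norm dominates the spectral norm, so the true matrices are controlled by the known
ones. -/
theorem norm2_mulVec_le_of_frobNorm_sub_le {k : ℕ} {M M' : Matrix (Fin n) (Fin k) ℝ} {δ : ℝ}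
    (h : frobNorm (M - M') ≤ δ) (x : Fin k → ℝ) :
    norm2 (M' *ᵥ x) ≤ (δ + specNorm M) * norm2 x := by
  have h1 : M' *ᵥ x = -((M - M') *ᵥ x) + M *ᵥ x := by
    rw [Matrix.sub_mulVec]
    abel
  have h2 := norm2_add_le (-((M - M') *ᵥ x)) (M *ᵥ x)
  have h3 := mul_le_mul_of_nonneg_right h (norm2_nonneg x)
  have h4 := norm2_mulVec_le_frobNorm (M - M') x
  have h5 := norm2_mulVec_le_specNorm M x
  rw [norm2_neg] at h2
  rw [h1]
  linarith

theorem frobNorm_nonneg {ι κ : Type} [Fintype ι] [Fintype κ] (M : Matrix ι κ ℝ) :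
    0 ≤ frobNorm M :=
  Real.sqrt_nonneg _

theorem norm2_openLoop_le (hA : frobNorm (C.Ah - A) ≤ δA) (hB : frobNorm (C.Bh - B) ≤ δB)
    (x : Fin n → ℝ) (u : ℕ → Fin m → ℝ) (k : ℕ) :
    norm2 (openLoop A B x u k) ≤ (δA + specNorm C.Ah) ^ k * norm2 x +
      ∑ i ∈ Finset.range k,
        (δB + specNorm C.Bh) * (δA + specNorm C.Ah) ^ (k - 1 - i) * norm2 (u i) := by
  induction k with
  | zero => simp [openLoop]
  | succ k ih =>
    have ha : 0 ≤ δA + specNorm C.Ah :=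
      add_nonneg ((frobNorm_nonneg _).trans hA) (specNorm_nonneg _)
    have h1 := norm2_add_le (A *ᵥ openLoop A B x u k) (B *ᵥ u k)
    have h2 := norm2_mulVec_le_of_frobNorm_sub_le hA (openLoop A B x u k)
    have h3 := norm2_mulVec_le_of_frobNorm_sub_le hB (u k)
    have h4 := mul_le_mul_of_nonneg_left ih ha
    rw [mul_add, Finset.mul_sum] at h4
    have h5 : ∀ i ∈ Finset.range k, (δA + specNorm C.Ah) *
        ((δB + specNorm C.Bh) * (δA + specNorm C.Ah) ^ (k - 1 - i) * norm2 (u i)) =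
        (δB + specNorm C.Bh) * (δA + specNorm C.Ah) ^ (k + 1 - 1 - i) * norm2 (u i) := by
      intro i hi
      have := Finset.mem_range.mp hi
      rw [show k + 1 - 1 - i = (k - 1 - i) + 1 by omega, pow_succ]
      ring
    rw [Finset.sum_congr rfl h5] at h4
    rw [Finset.sum_range_succ, openLoop, pow_succ']
    simp only [Nat.add_sub_cancel, Nat.sub_self, pow_zero, mul_one] at h4 ⊢
    linarith

/-- Together with `gu_succ`, this is the recursion obeyed by the prediction-error bound: old error
amplified by `‖Â‖`, plus `δA` times the growth bound of the true state. -/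
theorem gx_succ (k : ℕ) : C.gx δA (k + 1) =
    specNorm C.Ah * C.gx δA k + δA * (δA + specNorm C.Ah) ^ k := by
  rw [Controller.gx, Controller.gx]
  ring

theorem gu_succ (k : ℕ) : C.gu δA δB (k + 1) =
    specNorm C.Ah * C.gu δA δB k +
      δA * ((δB + specNorm C.Bh) * (δA + specNorm C.Ah) ^ k) := by
  rw [Controller.gu, Controller.gu, gx_succ]
  ring

theorem gu_zero : C.gu δA δB 0 = δB := by
  simp [Controller.gu, Controller.gx]

/-- The deviation of the predicted from the true open-loop state. -/
theorem norm2_openLoop_sub_le (hA : frobNorm (C.Ah - A) ≤ δA) (hB : frobNorm (C.Bh - B) ≤ δB)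
    (x : Fin n → ℝ) (u : ℕ → Fin m → ℝ) (k : ℕ) :
    norm2 (openLoop C.Ah C.Bh x u k - openLoop A B x u k) ≤ C.gx δA k * norm2 x +
      ∑ i ∈ Finset.range k, C.gu δA δB (k - 1 - i) * norm2 (u i) := by
  induction k with
  | zero => simp [openLoop, Controller.gx, norm2]
  | succ k ih =>
    have hδ : 0 ≤ δA := (frobNorm_nonneg _).trans hA
    set y := openLoop A B x u k with hy
    set d := openLoop C.Ah C.Bh x u k - y with hd
    -- The mismatch is evaluated at the true state `y`, so the growth bound `norm2_openLoop_le`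
    -- enters.
    have h0 : openLoop C.Ah C.Bh x u (k + 1) - openLoop A B x u (k + 1) =
        C.Ah *ᵥ d + ((C.Ah - A) *ᵥ y + (C.Bh - B) *ᵥ u k) := by
      simp only [openLoop, hd, ← hy, Matrix.sub_mulVec, Matrix.mulVec_sub]
      abel
    have h1 := norm2_add_le (C.Ah *ᵥ d) ((C.Ah - A) *ᵥ y + (C.Bh - B) *ᵥ u k)
    have h2 := norm2_add_le ((C.Ah - A) *ᵥ y) ((C.Bh - B) *ᵥ u k)
    have h3 := norm2_mulVec_le_specNorm C.Ah d
    have h4 := (norm2_mulVec_le_frobNorm (C.Ah - A) y).trans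
      (mul_le_mul_of_nonneg_right hA (norm2_nonneg y))
    have h5 := (norm2_mulVec_le_frobNorm (C.Bh - B) (u k)).trans
      (mul_le_mul_of_nonneg_right hB (norm2_nonneg (u k)))
    have h6 := mul_le_mul_of_nonneg_left ih (specNorm_nonneg C.Ah)
    have h7 := mul_le_mul_of_nonneg_left (norm2_openLoop_le hA hB x u k) hδ
    rw [mul_add, Finset.mul_sum] at h6 h7
    have h8 : ∀ i ∈ Finset.range k, C.gu δA δB (k + 1 - 1 - i) * norm2 (u i) =
        specNorm C.Ah * (C.gu δA δB (k - 1 - i) * norm2 (u i)) + δA * ((δB + specNorm C.Bh) *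
          (δA + specNorm C.Ah) ^ (k - 1 - i) * norm2 (u i)) := by
      intro i hi
      have := Finset.mem_range.mp hi
      rw [show k + 1 - 1 - i = (k - 1 - i) + 1 by omega, gu_succ]
      ring
    rw [Finset.sum_range_succ, Finset.sum_congr rfl h8, Finset.sum_add_distrib, h0, gx_succ,
      Nat.add_sub_cancel, Nat.sub_self, gu_zero]
    linarith

theorem norm2_sq_le_uMax (hU : Bornology.IsBounded (inputSet C.F)) {u : Fin m → ℝ}
    (hu : u ∈ inputSet C.F) : norm2 u ^ 2 ≤ C.uMax := by
  have h := (isCompact_inputSet hU).bddAbove_image (f := fun u => norm2 u ^ 2)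
    (continuous_norm2.pow 2).continuousOn
  refine le_csSup ?_ ⟨u, hu, rfl⟩
  obtain ⟨b, hb⟩ := h
  refine ⟨b, ?_⟩
  rintro r ⟨v, hv, rfl⟩
  exact hb ⟨v, hv, rfl⟩

/-- Cauchy–Schwarz on the index set enlarged by one point, which carries the initial-state term. -/
theorem sq_add_sum_mul_le {σ : Type*} (s : Finset σ) (a b : ℝ) (f g : σ → ℝ) :
    (a * b + ∑ i ∈ s, f i * g i) ^ 2 ≤
      (a ^ 2 + ∑ i ∈ s, f i ^ 2) * (b ^ 2 + ∑ i ∈ s, g i ^ 2) := by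
  have := Finset.sum_mul_sq_le_sq_mul_sq (Finset.insertNone s)
    (fun o => o.elim a f) (fun o => o.elim b g)
  simpa [Finset.sum_insertNone] using this

theorem norm2_openLoop_sub_sq_le (hU : Bornology.IsBounded (inputSet C.F))
    (hA : frobNorm (C.Ah - A) ≤ δA) (hB : frobNorm (C.Bh - B) ≤ δB)
    (x : Fin n → ℝ) {u : ℕ → Fin m → ℝ} (hu : ∀ k, u k ∈ inputSet C.F) (k : ℕ) :
    norm2 (openLoop C.Ah C.Bh x u k - openLoop A B x u k) ^ 2 ≤
      (C.gx δA k ^ 2 + ∑ i ∈ Finset.range k, C.gu δA δB (k - 1 - i) ^ 2) *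
        (norm2 x ^ 2 + k * C.uMax) := by
  have h1 := pow_le_pow_left₀ (norm2_nonneg _) (norm2_openLoop_sub_le hA hB x u k) 2
  refine (h1.trans (sq_add_sum_mul_le _ _ _ _ _)).trans (mul_le_mul_of_nonneg_left ?_
    (by positivity))
  have h2 : ∑ i ∈ Finset.range k, norm2 (u i) ^ 2 ≤ ∑ i ∈ Finset.range k, C.uMax :=
    Finset.sum_le_sum fun i _ => norm2_sq_le_uMax hU (hu i)
  simp only [Finset.sum_const, Finset.card_range, nsmul_eq_mul] at h2
  linarith

variable [Nonempty (Fin n)]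

theorem sum_wsq_openLoop_sub_le (hQ : C.Q.PosDef) (hU : Bornology.IsBounded (inputSet C.F))
    (hA : frobNorm (C.Ah - A) ≤ δA) (hB : frobNorm (C.Bh - B) ≤ δB)
    (x : Fin n → ℝ) {u : ℕ → Fin m → ℝ} (hu : ∀ k, u k ∈ inputSet C.F) :
    ∑ k ∈ Finset.range (C.N + 1), wsq C.Q (openLoop C.Ah C.Bh x u k - openLoop A B x u k) ≤
      C.errPsi δA δB x := by
  rw [Controller.errPsi, Controller.deltaPsi, Finset.mul_sum]
  exact Finset.sum_le_sum fun k _ => (wsq_le_eigMax_mul hQ.isHermitian _).trans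
    (mul_le_mul_of_nonneg_left (norm2_openLoop_sub_sq_le hU hA hB x hu k) (eigMax_pos hQ).le)

/-- The value of the estimated model is bounded by the true cost of any admissible input. -/
theorem value_le_trajCost (hQ : C.Q.PosDef) (hR : C.R.PosDef)
    (hU : Bornology.IsBounded (inputSet C.F))
    (hA : frobNorm (C.Ah - A) ≤ δA) (hB : frobNorm (C.Bh - B) ≤ δB) {p q : ℝ} (hp : 0 < p)
    (hpq : p * q = 1) (x : Fin n → ℝ) {u : ℕ → Fin m → ℝ} (hu : ∀ k, u k ∈ inputSet C.F) :
    C.value x ≤ (1 + p * √(C.errPsi δA δB x)) * trajCost A B C.Q C.R x u (C.N + 1) +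
      (q * √(C.errPsi δA δB x) + C.errPsi δA δB x) := by
  set E := C.errPsi δA δB x with hE
  set S := ∑ k ∈ Finset.range (C.N + 1), wsq C.Q (openLoop A B x u k) with hS
  have hS0 : 0 ≤ S := Finset.sum_nonneg fun k _ => wsq_nonneg hQ.posSemidef _
  have hT0 : 0 ≤ ∑ k ∈ Finset.range (C.N + 1), wsq C.R (u k) :=
    Finset.sum_nonneg fun k _ => wsq_nonneg hR.posSemidef _
  have h1 := Controller.value_le hU x hu
  have h2 := sum_wsq_add_le hQ.posSemidef (Finset.range (C.N + 1)) (openLoop A B x u)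
    (fun k => openLoop C.Ah C.Bh x u k - openLoop A B x u k) le_rfl
    (sum_wsq_openLoop_sub_le hQ hU hA hB x hu)
  simp only [add_sub_cancel] at h2
  simp only [Controller.modelCost, trajCost, stageCost, Finset.sum_add_distrib] at h1 ⊢
  -- Young's inequality with `p q = 1`, from `p (√S - q)² ≥ 0`.
  have h3 : 2 * √S ≤ p * S + q := by
    have h4 : 0 ≤ p * (√S - q) ^ 2 := by positivity
    have h5 : p * (√S - q) ^ 2 = p * (√S * √S) - 2 * (p * q) * √S + (p * q) * q := by ring
    rw [h5, Real.mul_self_sqrt hS0, hpq] at h4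
    linarith
  have h4 := mul_le_mul_of_nonneg_right h3 (Real.sqrt_nonneg E)
  have h5 : 0 ≤ p * √E * ∑ k ∈ Finset.range (C.N + 1), wsq C.R (u k) := by positivity
  linarith

omit [Nonempty (Fin n)] in
theorem ofReal_trajCost_le_costInf (hQ : C.Q.PosDef) (hR : C.R.PosDef) (x : Fin n → ℝ)
    (u : ℕ → Fin m → ℝ) (T : ℕ) :
    ENNReal.ofReal (trajCost A B C.Q C.R x u T) ≤ costInf A B C.Q C.R x u := by
  rw [trajCost, ENNReal.ofReal_sum_of_nonneg fun _ _ => stageCost_nonneg hQ hR _ _]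
  exact ENNReal.sum_le_tsum _

theorem value_le_valueInf (hQ : C.Q.PosDef) (hR : C.R.PosDef)
    (hU : Bornology.IsBounded (inputSet C.F))
    (hA : frobNorm (C.Ah - A) ≤ δA) (hB : frobNorm (C.Bh - B) ≤ δB) {p q : ℝ} (hp : 0 < p)
    (hpq : p * q = 1) {x : Fin n → ℝ} (hx : x ∈ regionOfAttraction A B C.Q C.R C.F) :
    C.value x ≤ (1 + p * √(C.errPsi δA δB x)) * (valueInf A B C.Q C.R C.F x).toReal +
      (q * √(C.errPsi δA δB x) + C.errPsi δA δB x) := by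
  have hpos : 0 < 1 + p * √(C.errPsi δA δB x) := by positivity
  -- The affine bound is solved for the true cost before the infimum is taken, so it becomes a lower
  -- bound uniform in the input sequence.
  have h1 : ENNReal.ofReal ((C.value x - (q * √(C.errPsi δA δB x) + C.errPsi δA δB x)) /
      (1 + p * √(C.errPsi δA δB x))) ≤ valueInf A B C.Q C.R C.F x := by
    refine le_iInf₂ fun u hu => le_trans (ENNReal.ofReal_le_ofReal ?_)
      (ofReal_trajCost_le_costInf hQ hR x u (C.N + 1))
    rw [div_le_iff₀ hpos]
    have := value_le_trajCost hQ hR hU hA hB hp hpq x hu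
    linarith
  rw [ENNReal.ofReal_le_iff_le_toReal (ne_of_lt hx), div_le_iff₀ hpos] at h1
  linarith

omit [Nonempty (Fin n)] in
theorem errU_nonneg [Nonempty (Fin m)] (hR : C.R.PosDef) (x : Fin n → ℝ) :
    0 ≤ C.errU δA δB x :=
  mul_nonneg (eigMax_pos hR).le (sq_nonneg _)

theorem errPsiU_nonneg [Nonempty (Fin m)] (hQ : C.Q.PosDef) (hR : C.R.PosDef) (x : Fin n → ℝ) :
    0 ≤ C.errPsiU δA δB x :=
  mul_nonneg (mul_nonneg (div_nonneg (eigMax_pos hQ).le (eigMax_pos hR).le) (sq_nonneg _))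
    (errU_nonneg hR x)

/-- The bound through `E_ψ` alone is already sufficient: the first entry of the maximum in `α_N`
contains `p₁ √E_ψ`, and the remaining summands of `β_N` are nonnegative. -/
theorem value_le_alpha_beta [Nonempty (Fin m)] (hQ : C.Q.PosDef) (hR : C.R.PosDef)
    (hU : Bornology.IsBounded (inputSet C.F))
    (hA : frobNorm (C.Ah - A) ≤ δA) (hB : frobNorm (C.Bh - B) ≤ δB) {p₁ p₂ p₃ q₁ q₂ q₃ : ℝ}
    (hp₁ : 0 < p₁) (hp₃ : 0 < p₃) (hq₂ : 0 < q₂) (hq₃ : 0 < q₃)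
    (hpq₁ : p₁ * q₁ = 1) {x : Fin n → ℝ} (hx : x ∈ regionOfAttraction A B C.Q C.R C.F) :
    C.value x ≤ (1 + C.alpha p₁ p₂ p₃ δA δB x) * (valueInf A B C.Q C.R C.F x).toReal +
      C.beta p₁ q₁ q₂ q₃ δA δB x := by
  have h1 := value_le_valueInf hQ hR hU hA hB hp₁ hpq₁ hx
  have hE := errPsiU_nonneg (δA := δA) (δB := δB) hQ hR x
  have hE' := errU_nonneg (δA := δA) (δB := δB) hR x
  have h2 : p₁ * √(C.errPsi δA δB x) ≤ C.alpha p₁ p₂ p₃ δA δB x := by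
    refine le_trans ?_ (le_max_left _ _)
    have : 0 ≤ p₃ * √(C.errPsiU δA δB x) := by positivity
    have : 0 ≤ p₁ * p₃ * √(C.errPsi δA δB x * C.errPsiU δA δB x) := by positivity
    linarith
  have h3 : q₁ * √(C.errPsi δA δB x) + C.errPsi δA δB x ≤ C.beta p₁ q₁ q₂ q₃ δA δB x := by
    have : 0 ≤ (1 + p₁ * √(C.errPsi δA δB x)) *
      (q₃ * √(C.errPsiU δA δB x) + C.errPsiU δA δB x) := by positivity
    have : 0 ≤ q₂ * √(C.errU δA δB x) := by positivity
    rw [Controller.beta]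
    linarith
  have h4 := mul_le_mul_of_nonneg_right h2
    (ENNReal.toReal_nonneg (a := valueInf A B C.Q C.R C.F x))
  linarith

end Perturbation

/-! ### Vanishing of the error terms for an exact model -/

section NoMismatch

variable {n m c : ℕ} (C : Controller n m c)

theorem gx_zero_mismatch (i : ℕ) : C.gx 0 i = 0 := by simp [Controller.gx]

theorem gu_zero_mismatch (i : ℕ) : C.gu 0 0 i = 0 := by simp [Controller.gu, gx_zero_mismatch]

theorem errPsi_zero_mismatch (x : Fin n → ℝ) : C.errPsi 0 0 x = 0 := by
  simp [Controller.errPsi, Controller.deltaPsi, gx_zero_mismatch, gu_zero_mismatch]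

theorem errU_zero_mismatch (x : Fin n → ℝ) : C.errU 0 0 x = 0 := by
  have h : C.deltaU 0 0 x = 0 := by
    simp only [Controller.deltaU, Controller.thetaU, Controller.thetaXU, Controller.gxSum,
      Controller.guSum, gx_zero_mismatch, gu_zero_mismatch, Finset.sum_const_zero]
    -- The second entry of the minimum vanishes, and the first is a square root, hence nonnegative.
    simp only [mul_zero, add_zero, zero_pow two_ne_zero, min_eq_right (Real.sqrt_nonneg _)]
  simp [Controller.errU, h]

theorem errPsiU_zero_mismatch (x : Fin n → ℝ) : C.errPsiU 0 0 x = 0 := by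
  simp [Controller.errPsiU, errU_zero_mismatch]

theorem alpha_zero_mismatch (p₁ p₂ p₃ : ℝ) (x : Fin n → ℝ) : C.alpha p₁ p₂ p₃ 0 0 x = 0 := by
  simp [Controller.alpha, errPsi_zero_mismatch, errU_zero_mismatch, errPsiU_zero_mismatch]

theorem beta_zero_mismatch (p₁ q₁ q₂ q₃ : ℝ) (x : Fin n → ℝ) :
    C.beta p₁ q₁ q₂ q₃ 0 0 x = 0 := by
  simp [Controller.beta, errPsi_zero_mismatch, errU_zero_mismatch, errPsiU_zero_mismatch]

theorem xi_zero_mismatch (L : LocalData n m) : C.xi L 0 0 = 0 := by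
  simp [Controller.xi, Controller.hErr]

end NoMismatch

/-! ### Stability, convergence and cost of the true closed loop -/

section ClosedLoop

variable {n m c : ℕ} {C : Controller n m c} {L : LocalData n m} {A : Matrix (Fin n) (Fin n) ℝ}
  {B : Matrix (Fin n) (Fin m) ℝ} {δA δB : ℝ} [Nonempty (Fin n)] [Nonempty (Fin m)]

/-- Telescoping and invariance go together: the accumulated cost is nonnegative, so the induction
hypothesis keeps the current state in the level set where the next descent step is valid. -/
theorem LocalData.Admissible.sum_closedLoop_le (hL : L.Admissible C) (hQ : C.Q.PosDef)
    (hR : C.R.PosDef) (hU : Bornology.IsBounded (inputSet C.F)) (hN : 1 ≤ C.N)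
    (hA : frobNorm (C.Ah - A) ≤ δA) (hB : frobNorm (C.Bh - B) ≤ δB)
    (hξη : C.xi L δA δB + C.eta L < 1) {x : Fin n → ℝ} (hx : C.value x ≤ descentLevel C L)
    (T : ℕ) :
    C.value (closedLoop A B C.law x T) + (1 - C.xi L δA δB - C.eta L) *
      ∑ t ∈ Finset.range T, stageCost C.Q C.R (closedLoop A B C.law x t)
        (C.law (closedLoop A B C.law x t)) ≤ C.value x := by
  induction T with
  | zero => simp [closedLoop]
  | succ T ih =>
    have h0 : 0 ≤ ∑ t ∈ Finset.range T, stageCost C.Q C.R (closedLoop A B C.law x t)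
        (C.law (closedLoop A B C.law x t)) :=
      Finset.sum_nonneg fun t _ => stageCost_nonneg hQ hR _ _
    have h1 := mul_nonneg (show 0 ≤ 1 - C.xi L δA δB - C.eta L by linarith) h0
    have h2 := hL.value_step_le hQ hR hU hN hA hB (x := closedLoop A B C.law x T) (by linarith)
    rw [Finset.sum_range_succ, closedLoop]
    linarith

theorem LocalData.Admissible.wsq_closedLoop_le (hL : L.Admissible C) (hQ : C.Q.PosDef)
    (hR : C.R.PosDef) (hU : Bornology.IsBounded (inputSet C.F)) (hN : 1 ≤ C.N)
    (hA : frobNorm (C.Ah - A) ≤ δA) (hB : frobNorm (C.Bh - B) ≤ δB)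
    (hξη : C.xi L δA δB + C.eta L < 1) {x : Fin n → ℝ} (hx : C.value x ≤ descentLevel C L)
    (t : ℕ) : wsq C.Q (closedLoop A B C.law x t) ≤ C.value x := by
  have h1 := hL.sum_closedLoop_le hQ hR hU hN hA hB hξη hx t
  have h0 : 0 ≤ ∑ t ∈ Finset.range t, stageCost C.Q C.R (closedLoop A B C.law x t)
      (C.law (closedLoop A B C.law x t)) :=
    Finset.sum_nonneg fun t _ => stageCost_nonneg hQ hR _ _
  have h2 := mul_nonneg (show 0 ≤ 1 - C.xi L δA δB - C.eta L by linarith) h0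
  have h3 := Controller.wsq_le_value hQ hR (closedLoop A B C.law x t)
  linarith

theorem LocalData.Admissible.lyapunov_stable (hL : L.Admissible C) (hQ : C.Q.PosDef)
    (hR : C.R.PosDef) (hU : Bornology.IsBounded (inputSet C.F)) (hN : 1 ≤ C.N)
    (hA : frobNorm (C.Ah - A) ≤ δA) (hB : frobNorm (C.Bh - B) ≤ δB)
    (hξη : C.xi L δA δB + C.eta L < 1) {ε : ℝ} (hε : 0 < ε) :
    ∃ δ > 0, ∀ x, norm2 x < δ → ∀ t, norm2 (closedLoop A B C.law x t) < ε := by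
  have hγ := hL.one_lt_gam hQ hR
  have hq := eigMin_pos hQ
  have hq' := eigMax_pos hQ
  have hε' := hL.eps_pos
  -- The first cap places `x` in the local region, where `V̂_N ≤ γ ‖x‖²_Q`; the second makes that
  -- bound smaller than `eigMin C.Q * ε ^ 2`.
  set r := min L.eps (eigMin C.Q * ε ^ 2 / C.gam L) with hr
  have hr0 : 0 < r := by positivity
  refine ⟨√(r / eigMax C.Q), by positivity, fun x hx t => ?_⟩
  have h1 : wsq C.Q x < r := by
    refine (wsq_le_eigMax_mul hQ.isHermitian x).trans_lt ?_
    have := (Real.lt_sqrt (norm2_nonneg x)).mp hx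
    rwa [lt_div_iff₀ hq', mul_comm] at this
  have h2 := hL.value_le_of_local hQ hR hU (h1.le.trans (min_le_left _ _))
  have h3 : C.gam L * wsq C.Q x < eigMin C.Q * ε ^ 2 := by
    have := h1.trans_le (min_le_right _ _)
    rwa [lt_div_iff₀ (by linarith), mul_comm] at this
  have h4 : C.value x ≤ descentLevel C L :=
    (h2.trans (mul_le_mul_of_nonneg_left (h1.le.trans (min_le_left _ _)) (by linarith))).trans
      (le_max_right _ _)
  have h5 := hL.wsq_closedLoop_le hQ hR hU hN hA hB hξη h4 t
  have h6 := eigMin_mul_le_wsq hQ.isHermitian (closedLoop A B C.law x t)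
  have h7 : norm2 (closedLoop A B C.law x t) ^ 2 < ε ^ 2 := by
    refine lt_of_mul_lt_mul_left ?_ hq.le
    linarith
  exact lt_of_pow_lt_pow_left₀ 2 hε.le h7

theorem LocalData.Admissible.sum_closedLoop_le_div (hL : L.Admissible C) (hQ : C.Q.PosDef)
    (hR : C.R.PosDef) (hU : Bornology.IsBounded (inputSet C.F)) (hN : 1 ≤ C.N)
    (hA : frobNorm (C.Ah - A) ≤ δA) (hB : frobNorm (C.Bh - B) ≤ δB)
    (hξη : C.xi L δA δB + C.eta L < 1) {x : Fin n → ℝ} (hx : C.value x ≤ descentLevel C L)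
    (T : ℕ) :
    ∑ t ∈ Finset.range T, stageCost C.Q C.R (closedLoop A B C.law x t)
      (C.law (closedLoop A B C.law x t)) ≤ C.value x / (1 - C.xi L δA δB - C.eta L) := by
  rw [le_div_iff₀ (by linarith), mul_comm]
  have h1 := hL.sum_closedLoop_le hQ hR hU hN hA hB hξη hx T
  have h2 := (wsq_nonneg hQ.posSemidef _).trans
    (Controller.wsq_le_value hQ hR (closedLoop A B C.law x T))
  linarith

theorem LocalData.Admissible.closedLoopCost_le (hL : L.Admissible C) (hQ : C.Q.PosDef)
    (hR : C.R.PosDef) (hU : Bornology.IsBounded (inputSet C.F)) (hN : 1 ≤ C.N)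
    (hA : frobNorm (C.Ah - A) ≤ δA) (hB : frobNorm (C.Bh - B) ≤ δB)
    (hξη : C.xi L δA δB + C.eta L < 1) {x : Fin n → ℝ} (hx : C.value x ≤ descentLevel C L) :
    closedLoopCost A B C.Q C.R C.law x ≤
      ENNReal.ofReal (C.value x / (1 - C.xi L δA δB - C.eta L)) := by
  refine ENNReal.tsum_le_of_sum_range_le fun T => ?_
  rw [← ENNReal.ofReal_sum_of_nonneg fun _ _ => stageCost_nonneg hQ hR _ _]
  exact ENNReal.ofReal_le_ofReal (hL.sum_closedLoop_le_div hQ hR hU hN hA hB hξη hx T)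

theorem LocalData.Admissible.tendsto_closedLoop (hL : L.Admissible C) (hQ : C.Q.PosDef)
    (hR : C.R.PosDef) (hU : Bornology.IsBounded (inputSet C.F)) (hN : 1 ≤ C.N)
    (hA : frobNorm (C.Ah - A) ≤ δA) (hB : frobNorm (C.Bh - B) ≤ δB)
    (hξη : C.xi L δA δB + C.eta L < 1) {x : Fin n → ℝ} (hx : C.value x ≤ descentLevel C L) :
    Filter.Tendsto (closedLoop A B C.law x) Filter.atTop (𝓝 0) := by
  -- Bounded partial sums make the stage costs tend to zero, and these dominate the squared state
  -- norm up to a constant.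
  have h1 := (summable_of_sum_range_le (fun _ => stageCost_nonneg hQ hR _ _)
    (hL.sum_closedLoop_le_div hQ hR hU hN hA hB hξη hx)).tendsto_atTop_zero
  have h2 : Filter.Tendsto (fun t => norm2 (closedLoop A B C.law x t) ^ 2) Filter.atTop (𝓝 0) := by
    refine squeeze_zero (fun _ => sq_nonneg _) (fun t => (norm2_sq_le_wsq hQ _).trans
      (mul_le_mul_of_nonneg_left (wsq_le_stageCost C.Q hR _ (C.law (closedLoop A B C.law x t)))
        (inv_nonneg.mpr (eigMin_pos hQ).le))) ?_
    simpa using h1.const_mul (eigMin C.Q)⁻¹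
  rw [tendsto_pi_nhds]
  intro i
  have h3 := h2.sqrt
  simp only [Real.sqrt_sq (norm2_nonneg _), Real.sqrt_zero] at h3
  refine squeeze_zero_norm (fun t => Real.abs_le_sqrt ?_) h3
  exact Finset.single_le_sum (f := fun i => closedLoop A B C.law x t i ^ 2)
    (fun i _ => sq_nonneg _) (Finset.mem_univ i)

end ClosedLoop

end CEMPC

end

/-! ### The main theorem -/

theorem mainTheorem1 {n m c : ℕ} (hn : 0 < n) (hm : 0 < m)
    -- the controller data: estimated model, weights, input constraints, horizon
    (C : CEMPC.Controller n m c) (hQ : C.Q.PosDef) (hR : C.R.PosDef)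
    (hU : Bornology.IsBounded (CEMPC.inputSet C.F)) (hN : 1 ≤ C.N)
    -- the true system and the error bounds
    (A : Matrix (Fin n) (Fin n) ℝ) (B : Matrix (Fin n) (Fin m) ℝ) (δA δB : ℝ)
    (hA : CEMPC.frobNorm (C.Ah - A) ≤ δA) (hB : CEMPC.frobNorm (C.Bh - B) ≤ δB)
    -- the parameters of the analysis
    (L : CEMPC.LocalData n m) (hL : L.Admissible C)
    (p₁ p₂ p₃ q₁ q₂ q₃ : ℝ) (hp₁ : 0 < p₁) (hp₂ : 0 < p₂) (hp₃ : 0 < p₃)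
    (hpq₁ : p₁ * q₁ = 1) (hpq₂ : p₂ * q₂ = 1) (hpq₃ : p₃ * q₃ = 1)
    (hξη : C.xi L δA δB + C.eta L < 1) :
    -- the MPC problem has a unique solution, so that the law and its value are well defined
    (∀ x, C.IsOptimal x (C.optInput x) ∧ ∀ u, C.IsOptimal x u → u = C.optInput x) ∧
    -- the origin is Lyapunov stable for the true closed loop
    (∀ ε > 0, ∃ δ > 0, ∀ x, CEMPC.norm2 x < δ →
      ∀ t, CEMPC.norm2 (CEMPC.closedLoop A B C.law x t) < ε) ∧
    -- convergence and the performance bound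
    (∀ x ∈ CEMPC.regionOfAttraction A B C.Q C.R C.F, C.value x ≤ L.M →
      Filter.Tendsto (CEMPC.closedLoop A B C.law x) Filter.atTop (𝓝 0) ∧
      CEMPC.closedLoopCost A B C.Q C.R C.law x < ⊤ ∧
      (CEMPC.closedLoopCost A B C.Q C.R C.law x).toReal ≤
        ((1 + C.alpha p₁ p₂ p₃ δA δB x) * (CEMPC.valueInf A B C.Q C.R C.F x).toReal +
          C.beta p₁ q₁ q₂ q₃ δA δB x) / (1 - C.xi L δA δB - C.eta L)) ∧
    -- without model mismatch the bound is the known one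
    (C.xi L 0 0 = 0 ∧ (∀ x, C.alpha p₁ p₂ p₃ 0 0 x = 0 ∧ C.beta p₁ q₁ q₂ q₃ 0 0 x = 0) ∧
      (δA = 0 → δB = 0 → ∀ x ∈ CEMPC.regionOfAttraction A B C.Q C.R C.F, C.value x ≤ L.M →
        (CEMPC.closedLoopCost A B C.Q C.R C.law x).toReal ≤
          (CEMPC.valueInf A B C.Q C.R C.F x).toReal / (1 - C.eta L))) := by
  have : Nonempty (Fin n) := ⟨⟨0, hn⟩⟩
  have : Nonempty (Fin m) := ⟨⟨0, hm⟩⟩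
  have hq₂ : 0 < q₂ := pos_of_mul_pos_right (hpq₂ ▸ one_pos) hp₂.le
  have hq₃ : 0 < q₃ := pos_of_mul_pos_right (hpq₃ ▸ one_pos) hp₃.le
  have hbound : ∀ x ∈ CEMPC.regionOfAttraction A B C.Q C.R C.F, C.value x ≤ L.M →
      (CEMPC.closedLoopCost A B C.Q C.R C.law x).toReal ≤
        ((1 + C.alpha p₁ p₂ p₃ δA δB x) * (CEMPC.valueInf A B C.Q C.R C.F x).toReal +
          C.beta p₁ q₁ q₂ q₃ δA δB x) / (1 - C.xi L δA δB - C.eta L) := fun x hx hM => by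
    have hpos : 0 ≤ 1 - C.xi L δA δB - C.eta L := by linarith
    refine (ENNReal.toReal_le_of_le_ofReal (div_nonneg ?_ hpos)
      (hL.closedLoopCost_le hQ hR hU hN hA hB hξη (hM.trans (le_max_left _ _)))).trans
      (div_le_div_of_nonneg_right (CEMPC.value_le_alpha_beta hQ hR hU hA hB hp₁ hp₃ hq₂ hq₃ hpq₁ hx)
        hpos)
    exact (CEMPC.wsq_nonneg hQ.posSemidef x).trans (CEMPC.Controller.wsq_le_value hQ hR x)
  refine ⟨fun x => ⟨CEMPC.Controller.isOptimal_optInput hU x, fun u hu =>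
      hu.unique hQ hR (CEMPC.Controller.isOptimal_optInput hU x)⟩,
    fun ε hε => hL.lyapunov_stable hQ hR hU hN hA hB hξη hε,
    fun x hx hM => ⟨hL.tendsto_closedLoop hQ hR hU hN hA hB hξη (hM.trans (le_max_left _ _)),
      (hL.closedLoopCost_le hQ hR hU hN hA hB hξη (hM.trans (le_max_left _ _))).trans_lt
        ENNReal.ofReal_lt_top, hbound x hx hM⟩,
    CEMPC.xi_zero_mismatch C L,
    fun x => ⟨CEMPC.alpha_zero_mismatch C p₁ p₂ p₃ x, CEMPC.beta_zero_mismatch C p₁ q₁ q₂ q₃ x⟩, ?_⟩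
  rintro rfl rfl x hx hM
  have h := hbound x hx hM
  rwa [CEMPC.alpha_zero_mismatch, CEMPC.beta_zero_mismatch, CEMPC.xi_zero_mismatch, add_zero,
    add_zero, one_mul, sub_zero] at h
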